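/- Let $\mathcal P$ be a normed plane ($\mathbb R^2$ with a norm) whose unit circle is smooth and quadratically convex (i.e. of positive curvature). Parametrize the unit circle smoothly by $p(\theta)$, $\theta\in\mathbb R$, where $\theta$ is the angle of the tangent vector $p'(\theta)\neq0$ with a fixed direction, so that $p(\theta+\pi)=-p(\theta)$. Write $[a,b]$ for the determinant of two plane vectors and $q=p'/[p,p']$ for the parametrization of the dual unit circle. Consider the equation $$\frac{1}{[p,p']}\left(\frac{u'}{[q,q']}\right)'=-\lambda u. \qquad (1)$$ An eigenfunction with eigenvalue $\lambda$ is a nonzero $2\pi$-periodic solution $u$ of (1). Its index is the number of clockwise turns that the closed plane curve $(u,\,u'/[q,q'])$ makes around the origin for $\theta\in[0,2\pi]$. For $k\ge1$ let $\lambda_k^1\le\lambda_k^2$ be the smallest and the largest eigenvalue that has an eigenfunction of index $k$, and let $h_k^1,h_k^2$ be eigenfunctions with eigenvalues $\lambda_k^1,\lambda_k^2$ that are orthonormal for the inner product $$\langle f,g\rangle=\int_0^{2\pi} f(\theta)\,g(\theta)\,[p,p'](\theta)\,d\theta .$$ Let $k_0\ge 2$ and let $h:\mathbb R\to\mathbb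 R$ be a continuous $2\pi$-periodic function with an expansion $$h=\sum_{k\ge k_0}\left(a_k^1h_k^1+a_k^2h_k^2\right),\qquad a_k^i\in\mathbb R,$$ converging in the norm of this inner product. Then $h$ has at least $2k_0$ distinct zeros in $[0,2\pi)$. -/

import Mathlib

open Filter Topology
open scoped ContDiff

namespace MinkowskiPlane

/-- The determinant `[a, b]` of a pair of vectors of the plane. -/
def det (a b : ℝ × ℝ) : ℝ := a.1 * b.2 - a.2 * b.1

/-- `p` parametrizes the unit circle of the norm `N` on `ℝ²` smoothly and regularly by the angle
`θ` that the tangent makes with a fixed direction. Such a parametrization exists exactly when the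
unit circle is smooth and quadratically convex (of positive curvature, here `1 / ρ`). -/
structure IsUnitCircle (N : Seminorm ℝ (ℝ × ℝ)) (p : ℝ → ℝ × ℝ) : Prop where
  definite : ∀ x, N x = 0 → x = 0
  smooth : ContDiff ℝ ∞ p
  range_eq : Set.range p = {x | N x = 1}
  antipodal : ∀ θ, p (θ + Real.pi) = -p θ
  tangent : ∃ c : ℝ, ∀ θ, ∃ ρ : ℝ, 0 < ρ ∧
    deriv p θ = (ρ * Real.cos (θ + c), ρ * Real.sin (θ + c))

/-- The weight `[p, p']`. -/
noncomputable def weight (p : ℝ → ℝ × ℝ) (θ : ℝ) : ℝ := det (p θ) (deriv p θ)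

/-- The parametrization `q = p' / [p, p']` of the dual unit circle. -/
noncomputable def dual (p : ℝ → ℝ × ℝ) (θ : ℝ) : ℝ × ℝ := (weight p θ)⁻¹ • deriv p θ

/-- The quotient `u' / [q, q']`. -/
noncomputable def quasiDeriv (p : ℝ → ℝ × ℝ) (u : ℝ → ℝ) (θ : ℝ) : ℝ :=
  deriv u θ / weight (dual p) θ

/-- `u` is a (classical) solution of `(1 / [p, p']) (u' / [q, q'])' = -lam u`. -/
structure IsSolution (p : ℝ → ℝ × ℝ) (lam : ℝ) (u : ℝ → ℝ) : Prop where
  differentiable : Differentiable ℝ u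
  differentiable_quasiDeriv : Differentiable ℝ (quasiDeriv p u)
  eqn : ∀ θ, (weight p θ)⁻¹ * deriv (quasiDeriv p u) θ = -lam * u θ

/-- `u` is an eigenfunction: a nonzero `2π`-periodic solution. -/
structure IsEigenfunction (p : ℝ → ℝ × ℝ) (lam : ℝ) (u : ℝ → ℝ) : Prop where
  isSolution : IsSolution p lam u
  periodic : Function.Periodic u (2 * Real.pi)
  ne_zero : u ≠ 0

/-- The index of `u`: the total variation `-(1 / 2π) ∫ β'` over `[0, 2π]`, where `β` is the angle of
the plane vector `(u, w)`, `w = u' / [q, q']`, so that `-β' = (w u' - u w') / (u² + w²)`. For a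
closed curve it is the number of clockwise turns of `(u, w)` around the origin. -/
noncomputable def index (p : ℝ → ℝ × ℝ) (u : ℝ → ℝ) : ℝ :=
  1 / (2 * Real.pi) * ∫ θ in (0 : ℝ)..(2 * Real.pi),
    (quasiDeriv p u θ * deriv u θ - u θ * deriv (quasiDeriv p u) θ) /
      (u θ ^ 2 + quasiDeriv p u θ ^ 2)

/-- The eigenvalues that admit an eigenfunction of index `k`. -/
def eigenvaluesOfIndex (p : ℝ → ℝ × ℝ) (k : ℕ) : Set ℝ :=
  {lam | ∃ u, IsEigenfunction p lam u ∧ index p u = k}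

/-- The smallest (`i = 0`) and the largest (`i = 1`) eigenvalue of index `k`; these are
`λ_k^1 ≤ λ_k^2`. -/
noncomputable def eigenvalue (p : ℝ → ℝ × ℝ) (k : ℕ) (i : Fin 2) : ℝ :=
  if i = 0 then sInf (eigenvaluesOfIndex p k) else sSup (eigenvaluesOfIndex p k)

/-- The inner product `⟨f, g⟩ = ∫ f g [p, p'] dθ` over one period. -/
noncomputable def innerProd (p : ℝ → ℝ × ℝ) (f g : ℝ → ℝ) : ℝ :=
  ∫ θ in (0 : ℝ)..(2 * Real.pi), f θ * g θ * weight p θ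

/-- `e k 0, e k 1` (`k ≥ 1`) is a system of normalized eigenfunctions for `λ_k^1, λ_k^2`, orthogonal
for each `k`. (For different `k` the eigenvalues differ and orthogonality is automatic; the
constants are the remaining member of the basis.) -/
structure IsEigenbasis (p : ℝ → ℝ × ℝ) (e : ℕ → Fin 2 → ℝ → ℝ) : Prop where
  isEigenfunction : ∀ k, 1 ≤ k → ∀ i, IsEigenfunction p (eigenvalue p k i) (e k i)
  orthonormal : ∀ k, 1 ≤ k → ∀ i j, innerProd p (e k i) (e k j) = if i = j then 1 else 0

/-- `f = ∑_{k ≥ k₀} ∑_i a_k^i e_k^i`, convergence being that of the norm of the inner product. -/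
def HasExpansionFrom (p : ℝ → ℝ × ℝ) (e : ℕ → Fin 2 → ℝ → ℝ) (k₀ : ℕ)
    (a : ℕ → Fin 2 → ℝ) (f : ℝ → ℝ) : Prop :=
  Tendsto (fun n : ℕ =>
    innerProd p (fun θ => f θ - ∑ k ∈ Finset.Icc k₀ n, ∑ i, a k i * e k i θ)
      (fun θ => f θ - ∑ k ∈ Finset.Icc k₀ n, ∑ i, a k i * e k i θ)) atTop (𝓝 0)

end MinkowskiPlane

/-!
The idea is that of Liouville and Sturm. Let `L u = -(1 / r) (u' / s)'` with `r = [p, p']` and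
`s = [q, q']`, both positive. By Rolle's theorem, applied to `u` and then to `u' / s`, the periodic
function `L u` has at least as many zeros in a period as `u`. For a combination `u` of
eigenfunctions, `L ^ n u` rescaled tends to the component of `u` with the largest eigenvalue, and
zeros are not lost in the limit, so `u` has at most as many zeros as that component. An
eigenfunction of index `k ≥ 1` has `2 k` zeros, since the clockwise angle of `(u, u' / s)` is
increasing. Hence a nonzero combination of the `2 m + 1` eigenfunctions of index at most `m` has at
most `2 m` zeros.

The number of sign changes of `h` in a period is even, say `2 m`. Some nonzero combination of those
`2 m + 1` eigenfunctions vanishes at all of them, hence nowhere else and with simple zeros, so its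
product with `h` is of one sign and they are not orthogonal. If `m < k₀`, this contradicts the
expansion of `h`.
-/

namespace SturmLiouville

open Set
open scoped Real

section Zeros

variable {T : ℝ} {f g : ℝ → ℝ}

/-- The number of zeros of `f` in the half-open interval `[0, T)`; for a `T`-periodic `f` this is
the number of zeros in one period. -/
noncomputable def zeroCount (T : ℝ) (f : ℝ → ℝ) : ℕ∞ := {x ∈ Ico 0 T | f x = 0}.encard

/-- Between any two zeros of `f` there is a zero of `g`, as when `g` is the derivative of `f`. -/
def ZerosSeparatedBy (f g : ℝ → ℝ) : Prop :=
  ∀ ⦃a b⦄, a < b → f a = 0 → f b = 0 → ∃ x ∈ Ioo a b, g x = 0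

lemma zeroCount_mono (h : ∀ x, f x = 0 → g x = 0) : zeroCount T f ≤ zeroCount T g :=
  encard_le_encard fun x hx => ⟨hx.1, h x hx.2⟩

lemma zeroCount_congr (h : ∀ x, f x = 0 ↔ g x = 0) : zeroCount T f = zeroCount T g :=
  le_antisymm (zeroCount_mono fun x => (h x).1) (zeroCount_mono fun x => (h x).2)

lemma card_le_zeroCount {Z : Finset ℝ} (hZ : ∀ z ∈ Z, z ∈ Ico 0 T ∧ f z = 0) :
    (Z.card : ℕ∞) ≤ zeroCount T f := by
  rw [← encard_coe_eq_coe_finsetCard]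
  exact encard_le_encard hZ

lemma exists_finset_of_le_zeroCount {n : ℕ} (h : (n : ℕ∞) ≤ zeroCount T f) :
    ∃ Z : Finset ℝ, (∀ z ∈ Z, z ∈ Ico 0 T ∧ f z = 0) ∧ Z.card = n := by
  obtain ⟨Z, hZ, hcard⟩ := exists_subset_encard_eq h
  have hfin : Z.Finite := finite_of_encard_eq_coe hcard
  refine ⟨hfin.toFinset, fun z hz => hZ (hfin.mem_toFinset.1 hz), ?_⟩
  rwa [← hfin.coe_toFinset, encard_coe_eq_coe_finsetCard, Nat.cast_inj] at hcard

lemma zerosSeparatedBy_of_hasDerivAt_mul {k : ℝ → ℝ} (hf : ∀ x, HasDerivAt f (k x * g x) x)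
    (hk : ∀ x, k x ≠ 0) : ZerosSeparatedBy f g := by
  intro a b hab ha hb
  obtain ⟨x, hx, hx0⟩ := exists_hasDerivAt_eq_zero hab
    (fun x _ => (hf x).continuousAt.continuousWithinAt) (ha.trans hb.symm) fun x _ => hf x
  exact ⟨x, hx, (mul_eq_zero.1 hx0).resolve_left (hk x)⟩

lemma exists_next_translate (hT : 0 < T) {Z : Finset ℝ} (z : ℝ) (hZ : Z.Nonempty) :
    ∃ y ∈ Z, ∃ m : ℤ, z < y + m • T ∧ ∀ x ∈ Z, ∀ n : ℤ, x + n • T ∉ Ioo z (y + m • T) := by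
  obtain ⟨y, hy, hmin⟩ := Z.exists_min_image (toIocMod hT z) hZ
  have hyz : y + (-toIocDiv hT z y) • T = toIocMod hT z y := by
    rw [neg_smul, ← sub_eq_add_neg, self_sub_toIocDiv_zsmul]
  refine ⟨y, hy, -toIocDiv hT z y, hyz ▸ left_lt_toIocMod hT z y, fun x hx n hn => ?_⟩
  rw [hyz] at hn
  have hself : toIocMod hT z x = x + n • T := by
    rw [← toIocMod_add_zsmul hT z x n, toIocMod_eq_self]
    exact ⟨hn.1, hn.2.le.trans (toIocMod_le_right hT z y)⟩
  exact (hn.2.trans_le (hmin x hx)).ne hself.symm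

lemma toIcoMod_zero_eq_iff (hT : 0 < T) {x t : ℝ} (ht : t ∈ Ico 0 T) :
    toIcoMod hT 0 x = t ↔ ∃ n : ℤ, x = t + n • T := by
  conv_lhs => rw [← (toIcoMod_eq_self hT).2 (show t ∈ Ico 0 (0 + T) by simpa using ht)]
  rw [eq_comm, toIcoMod_inj, AddCommGroup.modEq_iff_eq_add_zsmul]

/-- Cyclic Rolle theorem: the gaps around the circle `ℝ / Tℤ` between consecutive points of `Z` are
as many as the points, and each contains a zero of `g`. -/
lemma card_le_encard_zeros_diff (hT : 0 < T) (hf : Function.Periodic f T)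
    (hg : Function.Periodic g T) (hfg : ZerosSeparatedBy f g) {Z : Finset ℝ}
    (hZ : ∀ z ∈ Z, z ∈ Ico 0 T ∧ f z = 0) :
    (Z.card : ℕ∞) ≤ ({x ∈ Ico 0 T | g x = 0} \ (Z : Set ℝ)).encard := by
  have hgap : ∀ z ∈ Z, ∃ z' ξ, ξ ∈ Ioo z z' ∧ g ξ = 0 ∧
      ∀ x ∈ Z, ∀ n : ℤ, x + n • T ∉ Ioo z z' := by
    intro z hz
    obtain ⟨y, hy, m, hlt, hempty⟩ := exists_next_translate hT z ⟨z, hz⟩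
    have hfy : f (y + m • T) = 0 := ((hf.zsmul m) y).trans (hZ y hy).2
    obtain ⟨ξ, hξ, hgξ⟩ := hfg hlt (hZ z hz).2 hfy
    exact ⟨_, ξ, hξ, hgξ, hempty⟩
  choose! z' ξ hξ hgξ hempty using hgap
  rw [← encard_coe_eq_coe_finsetCard]
  refine encard_le_encard_of_injOn (f := fun z => toIcoMod hT 0 (ξ z)) (fun z hz => ?_) ?_
  · refine ⟨⟨by simpa using toIcoMod_mem_Ico hT 0 (ξ z), (hg.sub_zsmul_eq _).trans (hgξ z hz)⟩,
      fun hmem => ?_⟩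
    obtain ⟨n, hn⟩ := (toIcoMod_zero_eq_iff hT (hZ _ hmem).1).1 rfl
    exact hempty z hz _ hmem n (hn ▸ hξ z hz)
  · intro a ha b hb hab
    obtain ⟨n, hshift⟩ : ∃ n : ℤ, ξ a = ξ b + n • T :=
      AddCommGroup.modEq_iff_eq_add_zsmul.1 ((toIcoMod_inj hT).1 hab.symm)
    have hle : b + n • T ≤ a := by
      by_contra! hlt
      exact hempty a ha b hb _ ⟨hlt, by linarith [(hξ b hb).1, (hξ a ha).2]⟩
    have hge : a ≤ b + n • T := by
      by_contra! hlt
      refine hempty b hb a ha (-n) ⟨?_, ?_⟩ <;> rw [neg_smul] <;>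
        linarith [(hξ a ha).1, (hξ b hb).2]
    rw [← (toIcoMod_zero_eq_iff hT (hZ b hb).1).2 ⟨_, hge.antisymm hle⟩]
    exact ((toIcoMod_eq_self hT).2 (by simpa using (hZ a ha).1)).symm

lemma zeroCount_le_of_zerosSeparatedBy (hT : 0 < T) (hf : Function.Periodic f T)
    (hg : Function.Periodic g T) (hfg : ZerosSeparatedBy f g) : zeroCount T f ≤ zeroCount T g := by
  refine ENat.forall_natCast_le_iff_le.1 fun n hn => ?_
  obtain ⟨Z, hZ, rfl⟩ := exists_finset_of_le_zeroCount hn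
  exact (card_le_encard_zeros_diff hT hf hg hfg hZ).trans (encard_le_encard sdiff_subset)

lemma card_add_one_le_zeroCount (hT : 0 < T) (hf : Function.Periodic f T)
    (hg : Function.Periodic g T) (hfg : ZerosSeparatedBy f g) {Z : Finset ℝ}
    (hZ : ∀ z ∈ Z, z ∈ Ico 0 T ∧ f z = 0) {a : ℝ} (ha : a ∈ Z) (hga : g a = 0) :
    (Z.card : ℕ∞) + 1 ≤ zeroCount T g :=
  calc (Z.card : ℕ∞) + 1
      ≤ ({x ∈ Ico 0 T | g x = 0} \ (Z : Set ℝ)).encard + 1 :=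
        add_le_add_left (card_le_encard_zeros_diff hT hf hg hfg hZ) 1
    _ = (insert a ({x ∈ Ico 0 T | g x = 0} \ (Z : Set ℝ))).encard :=
        (encard_insert_of_notMem fun h => h.2 ha).symm
    _ ≤ zeroCount T g := encard_le_encard (insert_subset ⟨(hZ a ha).1, hga⟩ sdiff_subset)

end Zeros

section LimitsOfZeros

variable {ι : Type*} {l : Filter ι} {F G : ι → ℝ → ℝ} {f g : ℝ → ℝ} {T : ℝ}

lemma eq_zero_of_tendsto_zeros [l.NeBot] {x : ℝ}
    (hF : Tendsto (fun q : ι × ℝ => F q.1 q.2) (l ×ˢ 𝓝 x) (𝓝 (f x))) {a : ι → ℝ}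
    (ha : Tendsto a l (𝓝 x)) (hFa : ∀ n, F n (a n) = 0) : f x = 0 :=
  tendsto_nhds_unique (hF.comp (tendsto_id.prodMk ha)) (by simp [Function.comp_def, hFa])

lemma eq_zero_of_tendsto_distinct_zeros [l.NeBot] {x : ℝ}
    (hFG : ∀ n, ZerosSeparatedBy (F n) (G n))
    (hG : Tendsto (fun q : ι × ℝ => G q.1 q.2) (l ×ˢ 𝓝 x) (𝓝 (g x))) {a b : ι → ℝ}
    (ha : Tendsto a l (𝓝 x)) (hb : Tendsto b l (𝓝 x)) (hab : ∀ n, a n ≠ b n)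
    (hFa : ∀ n, F n (a n) = 0) (hFb : ∀ n, F n (b n) = 0) : g x = 0 := by
  have hbetween : ∀ n, ∃ ξ ∈ Ioo (min (a n) (b n)) (max (a n) (b n)), G n ξ = 0 := by
    intro n
    rcases (hab n).lt_or_gt with hlt | hlt
    · simpa [hlt.le] using hFG n hlt (hFa n) (hFb n)
    · simpa [hlt.le] using hFG n hlt (hFb n) (hFa n)
  choose ξ hξ hGξ using hbetween
  refine eq_zero_of_tendsto_zeros hG (tendsto_of_tendsto_of_tendsto_of_le_of_le
    (by simpa using ha.min hb) (by simpa using ha.max hb) (fun n => (hξ n).1.le)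
    fun n => (hξ n).2.le) hGξ

/-- Hurwitz-type principle: zeros are not lost in the limit, since two zeros that merge would force
a common zero of `f` and `g`. -/
lemma le_zeroCount_of_tendsto [l.NeBot] (hT : 0 < T) {N : ℕ∞} (hN : ∀ n, N ≤ zeroCount T (F n))
    (hFper : ∀ n, Function.Periodic (F n) T) (hfper : Function.Periodic f T)
    (hFG : ∀ n, ZerosSeparatedBy (F n) (G n))
    (hF : ∀ x, Tendsto (fun q : ι × ℝ => F q.1 q.2) (l ×ˢ 𝓝 x) (𝓝 (f x)))
    (hG : ∀ x, Tendsto (fun q : ι × ℝ => G q.1 q.2) (l ×ˢ 𝓝 x) (𝓝 (g x)))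
    (hfg : ∀ x, f x = 0 → g x ≠ 0) : N ≤ zeroCount T f := by
  refine ENat.forall_natCast_le_iff_le.1 fun k hk => ?_
  choose Z hZ hcard using fun n => exists_finset_of_le_zeroCount (hk.trans (hN n))
  let t (n : ι) (i : Fin k) : ℝ := (Z n).orderEmbOfFin (hcard n) i
  have ht : ∀ n i, t n i ∈ Ico 0 T ∧ F n (t n i) = 0 := fun n i =>
    hZ n _ ((Z n).orderEmbOfFin_mem (hcard n) i)
  have hlim : ∀ i, ∃ x, Tendsto (t · i) (Ultrafilter.of l) (𝓝 x) := by
    intro i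
    obtain ⟨x, -, hx⟩ := isCompact_Icc.ultrafilter_le_nhds ((Ultrafilter.of l).map (t · i))
      (tendsto_principal.2 (.of_forall fun n => Ico_subset_Icc_self (ht n i).1))
    exact ⟨x, hx⟩
  choose τ hτ using hlim
  have hl (x : ℝ) : (Ultrafilter.of l : Filter ι) ×ˢ 𝓝 x ≤ l ×ˢ 𝓝 x :=
    prod_mono_left _ (Ultrafilter.of_le l)
  have hfτ : ∀ i, f (τ i) = 0 := fun i =>
    eq_zero_of_tendsto_zeros ((hF _).mono_left (hl _)) (hτ i) fun n => (ht n i).2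
  have hinj : Function.Injective fun i => toIcoMod hT 0 (τ i) := by
    intro i j hij
    by_contra hne
    obtain ⟨m, hm⟩ : ∃ m : ℤ, τ i = τ j + m • T :=
      AddCommGroup.modEq_iff_eq_add_zsmul.1 ((toIcoMod_inj hT).1 hij.symm)
    refine hfg _ (hfτ i) (eq_zero_of_tendsto_distinct_zeros hFG ((hG _).mono_left (hl _)) (hτ i)
      (b := fun n => t n j + m • T) (hm ▸ (hτ j).add_const _) (fun n hn => hne ?_)
      (fun n => (ht n i).2) fun n => ((hFper n).zsmul m _).trans (ht n j).2)
    have hmod := (toIcoMod_zero_eq_iff hT (ht n j).1).2 ⟨m, hn⟩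
    rw [(toIcoMod_eq_self hT).2 (by simpa using (ht n i).1)] at hmod
    exact ((Z n).orderEmbOfFin (hcard n)).injective hmod
  calc (k : ℕ∞) = ((Finset.univ.image fun i => toIcoMod hT 0 (τ i)).card : ℕ∞) := by
        rw [Finset.card_image_of_injective _ hinj, Finset.card_fin]
    _ ≤ zeroCount T f := card_le_zeroCount (Finset.forall_mem_image.2 fun i _ =>
        ⟨by simpa using toIcoMod_mem_Ico hT 0 (τ i), (hfper.sub_zsmul_eq _).trans (hfτ i)⟩)

end LimitsOfZeros

section Integrals

variable {T : ℝ} {f : ℝ → ℝ}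

lemma eq_zero_of_integral_eq_zero (hT : 0 < T) (hf : Continuous f) (hper : Function.Periodic f T)
    (hnonneg : ∀ x, 0 ≤ f x) (hint : ∫ x in (0 : ℝ)..T, f x = 0) : f = 0 := by
  funext x
  by_contra hx
  refine (intervalIntegral.integral_pos hT hf.continuousOn (fun y _ => hnonneg y)
    ⟨toIcoMod hT 0 x, ?_, ?_⟩).ne' hint
  · exact Ico_subset_Icc_self (by simpa using toIcoMod_mem_Ico hT 0 x)
  · rw [toIcoMod, hper.sub_zsmul_eq]
    exact (hnonneg x).lt_of_ne' hx

end Integrals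

section LinearODE

variable {E : Type*} [NormedAddCommGroup E] [NormedSpace ℝ E]

lemma eq_zero_of_hasDerivAt_clm {A : ℝ → E →L[ℝ] E} {K : NNReal} (hA : ∀ t, ‖A t‖₊ ≤ K)
    {y : ℝ → E} (hy : ∀ t, HasDerivAt y (A t (y t)) t) {t₀ : ℝ} (h0 : y t₀ = 0) : y = 0 :=
  ODE_solution_unique_univ (v := fun t x => A t x) (s := fun _ => univ)
    (fun t => ((A t).lipschitz.weaken (hA t)).lipschitzOnWith) (fun t => ⟨hy t, mem_univ _⟩)
    (fun t => ⟨by simp, mem_univ _⟩) h0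

end LinearODE

section System

/-- Coefficients of the `T`-periodic Sturm–Liouville operator `L u = -(1 / r) (u' / s)'`: weights
`r`, `s` that are continuous, positive and `T`-periodic. -/
structure IsCoefficients (T : ℝ) (r s : ℝ → ℝ) : Prop where
  period_pos : 0 < T
  continuous_r : Continuous r
  continuous_s : Continuous s
  pos_r : ∀ x, 0 < r x
  pos_s : ∀ x, 0 < s x
  periodic_r : Function.Periodic r T
  periodic_s : Function.Periodic s T

/-- `v = L u` for the operator `L u = -(1 / r) (u' / s)'` on `T`-periodic functions, where
`w = u' / s` is the quasi-derivative of `u`. It is written as a first-order system, which asks no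
more of `s` and `r` than the equation needs. -/
structure IsImage (T : ℝ) (r s u w v : ℝ → ℝ) : Prop where
  hasDerivAt_u : ∀ x, HasDerivAt u (s x * w x) x
  hasDerivAt_w : ∀ x, HasDerivAt w (-r x * v x) x
  periodic_u : Function.Periodic u T
  periodic_w : Function.Periodic w T
  periodic_v : Function.Periodic v T

/-- `u` is a `T`-periodic solution of `L u = lam u` with quasi-derivative `w`, possibly zero. -/
abbrev IsEigen (T : ℝ) (r s : ℝ → ℝ) (lam : ℝ) (u w : ℝ → ℝ) : Prop :=
  IsImage T r s u w (lam • u)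

variable {T lam mu : ℝ} {r s u w v u₁ w₁ v₁ u₂ w₂ v₂ : ℝ → ℝ}

lemma IsCoefficients.integral_mul_self_pos (hc : IsCoefficients T r s) (hu : Continuous u)
    (hper : Function.Periodic u T) (hne : u ≠ 0) : 0 < ∫ x in (0 : ℝ)..T, u x * u x * r x := by
  have hr := hc.continuous_r
  have hnonneg : ∀ x, 0 ≤ u x * u x * r x := fun x =>
    mul_nonneg (mul_self_nonneg _) (hc.pos_r x).le
  refine (intervalIntegral.integral_nonneg hc.period_pos.le fun x _ => hnonneg x).lt_of_ne'
    fun h0 => hne ?_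
  have hzero := eq_zero_of_integral_eq_zero hc.period_pos (by fun_prop)
    (fun x => by simp only [hper x, hc.periodic_r x]) hnonneg h0
  funext x
  simpa [(hc.pos_r x).ne'] using congrFun hzero x

namespace IsImage

lemma continuous_u (h : IsImage T r s u w v) : Continuous u :=
  continuous_iff_continuousAt.2 fun x => (h.hasDerivAt_u x).continuousAt

lemma continuous_w (h : IsImage T r s u w v) : Continuous w :=
  continuous_iff_continuousAt.2 fun x => (h.hasDerivAt_w x).continuousAt

lemma sum {ι : Type*} {S : Finset ι} {U W V : ι → ℝ → ℝ}
    (h : ∀ i ∈ S, IsImage T r s (U i) (W i) (V i)) (c : ι → ℝ) :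
    IsImage T r s (∑ i ∈ S, c i • U i) (∑ i ∈ S, c i • W i) (∑ i ∈ S, c i • V i) where
  hasDerivAt_u x := by
    refine (HasDerivAt.sum fun i hi => ((h i hi).hasDerivAt_u x).const_smul (c i)).congr_deriv ?_
    simp only [Finset.sum_apply, Pi.smul_apply, smul_eq_mul, Finset.mul_sum, mul_left_comm]
  hasDerivAt_w x := by
    refine (HasDerivAt.sum fun i hi => ((h i hi).hasDerivAt_w x).const_smul (c i)).congr_deriv ?_
    simp only [Finset.sum_apply, Pi.smul_apply, smul_eq_mul, Finset.mul_sum, mul_left_comm]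
  periodic_u x := by
    simpa using Finset.sum_congr rfl fun i hi => congrArg (c i * ·) ((h i hi).periodic_u x)
  periodic_w x := by
    simpa using Finset.sum_congr rfl fun i hi => congrArg (c i * ·) ((h i hi).periodic_w x)
  periodic_v x := by
    simpa using Finset.sum_congr rfl fun i hi => congrArg (c i * ·) ((h i hi).periodic_v x)

lemma zerosSeparatedBy_quasiDeriv (hc : IsCoefficients T r s) (h : IsImage T r s u w v) :
    ZerosSeparatedBy u w :=
  zerosSeparatedBy_of_hasDerivAt_mul h.hasDerivAt_u fun x => (hc.pos_s x).ne'

lemma quasiDeriv_zerosSeparatedBy (hc : IsCoefficients T r s) (h : IsImage T r s u w v) :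
    ZerosSeparatedBy w v :=
  zerosSeparatedBy_of_hasDerivAt_mul h.hasDerivAt_w fun x => neg_ne_zero.2 (hc.pos_r x).ne'

lemma zeroCount_quasiDeriv_le (hc : IsCoefficients T r s) (h : IsImage T r s u w v) :
    zeroCount T w ≤ zeroCount T v :=
  zeroCount_le_of_zerosSeparatedBy hc.period_pos h.periodic_w h.periodic_v
    (h.quasiDeriv_zerosSeparatedBy hc)

lemma zeroCount_le (hc : IsCoefficients T r s) (h : IsImage T r s u w v) :
    zeroCount T u ≤ zeroCount T v :=
  (zeroCount_le_of_zerosSeparatedBy hc.period_pos h.periodic_u h.periodic_w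
    (h.zerosSeparatedBy_quasiDeriv hc)).trans (h.zeroCount_quasiDeriv_le hc)

lemma integral_mul_image (hc : IsCoefficients T r s) (h₁ : IsImage T r s u₁ w₁ v₁)
    (h₂ : IsImage T r s u₂ w₂ v₂) (hv : Continuous v₂) :
    ∫ x in (0 : ℝ)..T, u₁ x * v₂ x * r x = ∫ x in (0 : ℝ)..T, s x * (w₁ x * w₂ x) := by
  have hu := h₁.continuous_u
  have hw₁ := h₁.continuous_w
  have hw₂ := h₂.continuous_w
  have hr := hc.continuous_r
  have hs := hc.continuous_s
  have hderiv : ∀ x, HasDerivAt (u₁ * w₂) (s x * (w₁ x * w₂ x) - u₁ x * v₂ x * r x) x := fun x =>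
    ((h₁.hasDerivAt_u x).mul (h₂.hasDerivAt_w x)).congr_deriv (by ring)
  have hftc := intervalIntegral.integral_eq_sub_of_hasDerivAt (a := 0) (b := T)
    (fun x _ => hderiv x) (Continuous.intervalIntegrable (by fun_prop) _ _)
  rw [intervalIntegral.integral_sub (Continuous.intervalIntegrable (by fun_prop) _ _)
    (Continuous.intervalIntegrable (by fun_prop) _ _)] at hftc
  have hend : (u₁ * w₂) T = (u₁ * w₂) 0 := by
    simpa using congrArg₂ (· * ·) (h₁.periodic_u 0) (h₂.periodic_w 0)
  linarith

end IsImage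

namespace IsEigen

lemma sum {ι : Type*} {S : Finset ι} {U W : ι → ℝ → ℝ} (h : ∀ i ∈ S, IsEigen T r s lam (U i) (W i))
    (c : ι → ℝ) : IsEigen T r s lam (∑ i ∈ S, c i • U i) (∑ i ∈ S, c i • W i) := by
  simpa only [IsEigen, Finset.smul_sum, smul_comm lam] using IsImage.sum h c

lemma eq_zero_of_initial (hc : IsCoefficients T r s) (h : IsEigen T r s lam u w) {t : ℝ}
    (hu : u t = 0) (hw : w t = 0) : u = 0 ∧ w = 0 := by
  let A (x : ℝ) : ℝ × ℝ →L[ℝ] ℝ × ℝ :=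
    s x • (ContinuousLinearMap.inl ℝ ℝ ℝ ∘L ContinuousLinearMap.snd ℝ ℝ ℝ) -
      (r x * lam) • (ContinuousLinearMap.inr ℝ ℝ ℝ ∘L ContinuousLinearMap.fst ℝ ℝ ℝ)
  have hAcont : Continuous A := by
    have hr := hc.continuous_r
    have hs := hc.continuous_s
    fun_prop
  have hAper : Function.Periodic A T := fun x => by simp only [A, hc.periodic_r x, hc.periodic_s x]
  obtain ⟨C, hC⟩ := (hAper.isBounded_of_continuous hc.period_pos.ne' hAcont).exists_norm_le
  have hderiv : ∀ x, HasDerivAt (fun x => (u x, w x)) (A x (u x, w x)) x := fun x =>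
    ((h.hasDerivAt_u x).prodMk (h.hasDerivAt_w x)).congr_deriv
      (by simp [A, mul_assoc])
  have hzero : (fun x => (u x, w x)) = 0 :=
    eq_zero_of_hasDerivAt_clm (K := C.toNNReal)
      (fun x => NNReal.coe_le_coe.1 ((hC _ ⟨x, rfl⟩).trans (Real.le_coe_toNNReal C))) hderiv
      (t₀ := t) (by simp [hu, hw])
  exact ⟨funext fun x => congrArg Prod.fst (congrFun hzero x),
    funext fun x => congrArg Prod.snd (congrFun hzero x)⟩

lemma quasiDeriv_ne_zero (hc : IsCoefficients T r s) (h : IsEigen T r s lam u w) (hne : u ≠ 0)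
    {t : ℝ} (hu : u t = 0) : w t ≠ 0 :=
  fun hw => hne (h.eq_zero_of_initial hc hu hw).1

lemma mul_integral_eq (hc : IsCoefficients T r s) (h₁ : IsEigen T r s lam u₁ w₁)
    (h₂ : IsEigen T r s mu u₂ w₂) :
    mu * ∫ x in (0 : ℝ)..T, u₁ x * u₂ x * r x = ∫ x in (0 : ℝ)..T, s x * (w₁ x * w₂ x) := by
  rw [← h₁.integral_mul_image hc h₂ (h₂.continuous_u.const_smul mu),
    ← intervalIntegral.integral_const_mul]
  congr 1 with x
  simp only [Pi.smul_apply, smul_eq_mul]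
  ring

lemma integral_mul_eq_zero (hc : IsCoefficients T r s) (h₁ : IsEigen T r s lam u₁ w₁)
    (h₂ : IsEigen T r s mu u₂ w₂) (hne : lam ≠ mu) :
    ∫ x in (0 : ℝ)..T, u₁ x * u₂ x * r x = 0 := by
  have h₁₂ := h₁.mul_integral_eq hc h₂
  have h₂₁ := h₂.mul_integral_eq hc h₁
  simp only [mul_comm (u₂ _), mul_comm (w₂ _)] at h₂₁
  exact (mul_eq_zero.1 (show (lam - mu) * _ = 0 by linear_combination h₂₁ - h₁₂)).resolve_left
    (sub_ne_zero.2 hne)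

lemma nonneg (hc : IsCoefficients T r s) (h : IsEigen T r s lam u w) (hne : u ≠ 0) :
    0 ≤ lam := by
  refine nonneg_of_mul_nonneg_left ?_
    (hc.integral_mul_self_pos h.continuous_u h.periodic_u hne)
  rw [h.mul_integral_eq hc h]
  exact intervalIntegral.integral_nonneg hc.period_pos.le fun x _ =>
    mul_nonneg (hc.pos_s x).le (mul_self_nonneg _)

lemma quasiDeriv_eq_zero (hc : IsCoefficients T r s) (h : IsEigen T r s 0 u w) : w = 0 := by
  have hs := hc.continuous_s
  have hw := h.continuous_w
  have henergy := h.mul_integral_eq hc h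
  rw [zero_mul] at henergy
  have hzero := eq_zero_of_integral_eq_zero hc.period_pos (by fun_prop)
    (fun x => by simp only [h.periodic_w x, hc.periodic_s x])
    (fun x => mul_nonneg (hc.pos_s x).le (mul_self_nonneg _)) henergy.symm
  funext x
  simpa [(hc.pos_s x).ne'] using congrFun hzero x

lemma eq_const (hc : IsCoefficients T r s) (h : IsEigen T r s 0 u w) (x : ℝ) : u x = u 0 :=
  is_const_of_deriv_eq_zero (fun y => (h.hasDerivAt_u y).differentiableAt)
    (fun y => by rw [(h.hasDerivAt_u y).deriv, h.quasiDeriv_eq_zero hc, Pi.zero_apply, mul_zero])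
    x 0

lemma wronskian_eq (h₁ : IsEigen T r s lam u₁ w₁) (h₂ : IsEigen T r s lam u₂ w₂) (x y : ℝ) :
    u₁ x * w₂ x - u₂ x * w₁ x = u₁ y * w₂ y - u₂ y * w₁ y := by
  have hderiv : ∀ x, HasDerivAt (u₁ * w₂ - u₂ * w₁) 0 x := fun x =>
    (((h₁.hasDerivAt_u x).mul (h₂.hasDerivAt_w x)).sub
      ((h₂.hasDerivAt_u x).mul (h₁.hasDerivAt_w x))).congr_deriv (by
        simp only [Pi.smul_apply, smul_eq_mul]; ring)
  exact is_const_of_deriv_eq_zero (fun x => (hderiv x).differentiableAt)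
    (fun x => (hderiv x).deriv) x y

lemma zerosSeparatedBy_of_wronskian_ne_zero (hc : IsCoefficients T r s)
    (h₁ : IsEigen T r s lam u₁ w₁) (h₂ : IsEigen T r s lam u₂ w₂)
    (hW : ∀ x, u₁ x * w₂ x - u₂ x * w₁ x ≠ 0) : ZerosSeparatedBy u₁ u₂ := by
  intro a b hab ha hb
  by_contra! hne
  have hne_end : ∀ x, u₁ x = 0 → u₂ x ≠ 0 := fun x hx hx' => hW x (by simp [hx, hx'])
  have hne_Icc : ∀ x ∈ Icc a b, u₂ x ≠ 0 := by
    intro x hx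
    rcases eq_endpoints_or_mem_Ioo_of_mem_Icc hx with rfl | rfl | hx
    exacts [hne_end _ ha, hne_end _ hb, hne x hx]
  have hquot : ∀ x ∈ Icc a b, HasDerivAt (u₁ / u₂)
      (-s x * (u₁ x * w₂ x - u₂ x * w₁ x) / u₂ x ^ 2) x := fun x hx =>
    ((h₁.hasDerivAt_u x).div (h₂.hasDerivAt_u x) (hne_Icc x hx)).congr_deriv (by ring)
  obtain ⟨x, hx, hx0⟩ := exists_hasDerivAt_eq_zero hab
    (fun x hx => (hquot x hx).continuousAt.continuousWithinAt) (by simp [ha, hb])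
    fun x hx => hquot x (Ioo_subset_Icc_self hx)
  exact div_ne_zero (mul_ne_zero (neg_ne_zero.2 (hc.pos_s x).ne') (hW x))
    (pow_ne_zero 2 (hne x hx)) hx0

lemma zeroCount_le_of_same_eigenvalue (hc : IsCoefficients T r s) (h₁ : IsEigen T r s lam u₁ w₁)
    (h₂ : IsEigen T r s lam u₂ w₂) (hne : u₁ ≠ 0) : zeroCount T u₁ ≤ zeroCount T u₂ := by
  by_cases hW : u₁ 0 * w₂ 0 - u₂ 0 * w₁ 0 = 0
  · refine zeroCount_mono fun x hx => ?_
    have hWx := (h₁.wronskian_eq h₂ x 0).trans hW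
    rw [hx, zero_mul, zero_sub, neg_eq_zero] at hWx
    exact (mul_eq_zero.1 hWx).resolve_right (h₁.quasiDeriv_ne_zero hc hne hx)
  · exact zeroCount_le_of_zerosSeparatedBy hc.period_pos h₁.periodic_u h₂.periodic_u
      (h₁.zerosSeparatedBy_of_wronskian_ne_zero hc h₂ fun x => h₁.wronskian_eq h₂ x 0 ▸ hW)

end IsEigen

end System

section Chebyshev

variable {T : ℝ} {r s : ℝ → ℝ} {ι : Type*} {lam c : ι → ℝ} {U W : ι → ℝ → ℝ}

lemma tendsto_smul_sum {κ : Type*} {l : Filter κ} {S : Finset ι} {a : κ → ι → ℝ} {b : ι → ℝ}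
    (ha : ∀ i ∈ S, Tendsto (a · i) l (𝓝 (b i))) (hU : ∀ i ∈ S, Continuous (U i)) (x : ℝ) :
    Tendsto (fun q : κ × ℝ => (∑ i ∈ S, a q.1 i • U i) q.2) (l ×ˢ 𝓝 x)
      (𝓝 ((∑ i ∈ S, b i • U i) x)) := by
  simp only [Finset.sum_apply, Pi.smul_apply, smul_eq_mul]
  exact tendsto_finsetSum S fun i hi =>
    ((ha i hi).comp tendsto_fst).mul (((hU i hi).tendsto x).comp tendsto_snd)

lemma tendsto_mul_div_pow {L μ : ℝ} (hμ : 0 ≤ μ) (hL : μ ≤ L) (hL0 : 0 < L) (a : ℝ) :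
    Tendsto (fun n : ℕ => a * (μ / L) ^ n) atTop (𝓝 (if μ = L then a else 0)) := by
  split_ifs with h
  · simp [h, hL0.ne']
  · simpa using (tendsto_pow_atTop_nhds_zero_of_lt_one (div_nonneg hμ hL0.le)
      ((div_lt_one hL0).2 (lt_of_le_of_ne hL h))).const_mul a

/-- Liouville's iteration: by Rolle's theorem `L ^ n` does not decrease the number of zeros. -/
lemma zeroCount_sum_le_zeroCount_sum_pow (hc : IsCoefficients T r s) {S : Finset ι}
    (hU : ∀ i ∈ S, IsEigen T r s (lam i) (U i) (W i)) {L : ℝ} (hL : L ≠ 0) (n : ℕ) :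
    zeroCount T (∑ i ∈ S, c i • U i) ≤ zeroCount T (∑ i ∈ S, (c i * (lam i / L) ^ n) • U i) := by
  induction n with
  | zero => simp
  | succ n ih =>
    refine (ih.trans ((IsImage.sum hU _).zeroCount_le hc)).trans_eq (zeroCount_congr fun x => ?_)
    have hscale : ∑ i ∈ S, (c i * (lam i / L) ^ n) • lam i • U i =
        L • ∑ i ∈ S, (c i * (lam i / L) ^ (n + 1)) • U i := by
      simp only [Finset.smul_sum, smul_smul]
      refine Finset.sum_congr rfl fun i _ => ?_
      congr 1
      rw [pow_succ]
      field_simp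
    rw [hscale, Pi.smul_apply, smul_eq_mul, mul_eq_zero, or_iff_right hL]

/-- Sturm's theorem: the iterates of Liouville, rescaled, converge to the component of largest
eigenvalue. -/
theorem zeroCount_sum_le_zeroCount_top (hc : IsCoefficients T r s) {S : Finset ι}
    (hU : ∀ i ∈ S, IsEigen T r s (lam i) (U i) (W i)) {L : ℝ}
    (hlam : ∀ i ∈ S, 0 ≤ lam i ∧ lam i ≤ L) (htop : ∑ i ∈ S with lam i = L, c i • U i ≠ 0) :
    zeroCount T (∑ i ∈ S, c i • U i) ≤ zeroCount T (∑ i ∈ S with lam i = L, c i • U i) := by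
  obtain ⟨i₀, hi₀⟩ : (S.filter (lam · = L)).Nonempty :=
    Finset.nonempty_of_ne_empty fun h => htop (by simp [h])
  have hLi₀ := (Finset.mem_filter.1 hi₀).2
  rcases (hLi₀ ▸ (hlam i₀ (Finset.mem_filter.1 hi₀).1).1).eq_or_lt with hL0 | hL0
  · rw [Finset.filter_true_of_mem fun i hi =>
      (hlam i hi).2.antisymm (hL0 ▸ (hlam i hi).1)]
  have hcoeff : ∀ i ∈ S, Tendsto (fun n : ℕ => c i * (lam i / L) ^ n) atTop
      (𝓝 (if lam i = L then c i else 0)) := fun i hi =>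
    tendsto_mul_div_pow (hlam i hi).1 (hlam i hi).2 hL0 (c i)
  have hfilter : ∀ V : ι → ℝ → ℝ, ∑ i ∈ S, (if lam i = L then c i else 0) • V i =
      ∑ i ∈ S with lam i = L, c i • V i := fun V => by
    simp only [Finset.sum_filter, ite_smul, zero_smul]
  have hlimit : IsEigen T r s L (∑ i ∈ S with lam i = L, c i • U i)
      (∑ i ∈ S with lam i = L, c i • W i) :=
    IsEigen.sum (fun i hi => (Finset.mem_filter.1 hi).2 ▸ hU i (Finset.mem_filter.1 hi).1) c
  refine le_zeroCount_of_tendsto (l := atTop) hc.period_pos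
    (zeroCount_sum_le_zeroCount_sum_pow hc hU hL0.ne')
    (fun n => (IsImage.sum hU _).periodic_u) hlimit.periodic_u
    (fun n => (IsImage.sum hU _).zerosSeparatedBy_quasiDeriv hc)
    (fun x => hfilter U ▸ tendsto_smul_sum hcoeff (fun i hi => (hU i hi).continuous_u) x)
    (fun x => hfilter W ▸ tendsto_smul_sum hcoeff (fun i hi => (hU i hi).continuous_w) x)
    fun x hx => hlimit.quasiDeriv_ne_zero hc htop hx

variable [Fintype ι] {M : ℕ∞}

theorem zeroCount_sum_le (hc : IsCoefficients T r s)
    (hU : ∀ i, IsEigen T r s (lam i) (U i) (W i)) (hind : LinearIndependent ℝ U)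
    (hM : ∀ i, zeroCount T (U i) ≤ M) (hne : c ≠ 0) : zeroCount T (∑ i, c i • U i) ≤ M := by
  let S := Finset.univ.filter (c · ≠ 0)
  obtain ⟨j, hj⟩ := Function.ne_iff.1 hne
  obtain ⟨i₀, hi₀, hmax⟩ := S.exists_max_image lam ⟨j, by simpa [S] using hj⟩
  have hsum : ∑ i, c i • U i = ∑ i ∈ S, c i • U i :=
    (Finset.sum_subset (Finset.filter_subset _ _) fun i _ hi => by
      rw [show c i = 0 by simpa [S] using hi, zero_smul]).symm
  have htop : ∑ i ∈ S with lam i = lam i₀, c i • U i ≠ 0 := fun h0 =>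
    (Finset.mem_filter.1 hi₀).2 (linearIndependent_iff'.1 hind _ c h0 i₀ (by simp [hi₀]))
  have hS : ∀ i ∈ S, 0 ≤ lam i ∧ lam i ≤ lam i₀ := fun i hi =>
    ⟨(hU i).nonneg hc (hind.ne_zero i), hmax i hi⟩
  have heigen : IsEigen T r s (lam i₀) (∑ i ∈ S with lam i = lam i₀, c i • U i)
      (∑ i ∈ S with lam i = lam i₀, c i • W i) :=
    IsEigen.sum (fun i hi => (Finset.mem_filter.1 hi).2 ▸ hU i) c
  calc zeroCount T (∑ i, c i • U i)
      ≤ zeroCount T (∑ i ∈ S with lam i = lam i₀, c i • U i) :=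
        hsum ▸ zeroCount_sum_le_zeroCount_top hc (fun i _ => hU i) hS htop
    _ ≤ zeroCount T (U i₀) := heigen.zeroCount_le_of_same_eigenvalue hc (hU i₀) htop
    _ ≤ M := hM i₀

lemma exists_ne_zero_vanishing (U : ι → ℝ → ℝ) (Z : Finset ℝ) (hZ : Z.card < Fintype.card ι) :
    ∃ c : ι → ℝ, c ≠ 0 ∧ ∀ z ∈ Z, (∑ i, c i • U i) z = 0 := by
  let ev : (ι → ℝ) →ₗ[ℝ] (Z → ℝ) :=
    LinearMap.funLeft ℝ ℝ ((↑) : Z → ℝ) ∘ₗ Fintype.linearCombination ℝ U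
  obtain ⟨c, hc, hc0⟩ := Submodule.exists_mem_ne_zero_of_ne_bot
    (ev.ker_ne_bot_of_finrank_lt (by simpa using hZ))
  exact ⟨c, hc0, fun z hz => congrFun (LinearMap.mem_ker.1 hc) ⟨z, hz⟩⟩

theorem card_le_of_zeroCount_le {M : ℕ} (hc : IsCoefficients T r s)
    (hU : ∀ i, IsEigen T r s (lam i) (U i) (W i)) (hind : LinearIndependent ℝ U)
    (hM : ∀ i, zeroCount T (U i) ≤ M) : Fintype.card ι ≤ M + 1 := by
  by_contra! hlt
  obtain ⟨Z, hZ, hcard⟩ := (Ico_infinite hc.period_pos).exists_subset_card_eq (M + 1)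
  obtain ⟨c, hne, hvanish⟩ := exists_ne_zero_vanishing U Z (hcard ▸ hlt)
  have hle := (card_le_zeroCount fun z hz => ⟨hZ hz, hvanish z hz⟩).trans
    (zeroCount_sum_le hc hU hind hM hne)
  rw [hcard, Nat.cast_le] at hle
  omega

section SimpleZeros

variable {Z : Finset ℝ}

lemma mem_of_zeroCount_le_card (hc : IsCoefficients T r s)
    (hU : ∀ i, IsEigen T r s (lam i) (U i) (W i)) (hind : LinearIndependent ℝ U)
    (hM : ∀ i, zeroCount T (U i) ≤ Z.card) (hne : c ≠ 0)
    (hZ : ∀ z ∈ Z, z ∈ Ico 0 T ∧ (∑ i, c i • U i) z = 0) {x : ℝ} (hx : x ∈ Ico 0 T)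
    (hx0 : (∑ i, c i • U i) x = 0) : x ∈ Z := by
  by_contra hxZ
  have hle := (card_le_zeroCount (Z := insert x Z)
    (Finset.forall_mem_insert _ _ _ |>.2 ⟨⟨hx, hx0⟩, hZ⟩)).trans
    (zeroCount_sum_le hc hU hind hM hne)
  rw [Finset.card_insert_of_notMem hxZ, Nat.cast_le] at hle
  omega

/-- If the quasi-derivative vanished too, Rolle's theorem would give `L` of the combination one zero
more than a combination of the `U i` can have. -/
lemma quasiDeriv_sum_ne_zero (hc : IsCoefficients T r s)
    (hU : ∀ i, IsEigen T r s (lam i) (U i) (W i)) (hind : LinearIndependent ℝ U)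
    (hM : ∀ i, zeroCount T (U i) ≤ Z.card) (hne : c ≠ 0)
    (hZ : ∀ z ∈ Z, z ∈ Ico 0 T ∧ (∑ i, c i • U i) z = 0) {x : ℝ} (hx : x ∈ Z) :
    (∑ i, c i • W i) x ≠ 0 := by
  intro hWx
  have himage := IsImage.sum (S := Finset.univ) (fun i _ => hU i) c
  simp only [smul_smul] at himage
  by_cases hlam : (fun i => c i * lam i) = 0
  · have hzero : IsEigen T r s 0 (∑ i, c i • U i) (∑ i, c i • W i) := by
      simpa only [IsEigen, congrFun hlam, Pi.zero_apply, zero_smul, Finset.sum_const_zero]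
        using himage
    exact hne (funext (Fintype.linearIndependent_iff.1 hind c
      (hzero.eq_zero_of_initial hc (hZ x hx).2 hWx).1))
  · have hle := (card_add_one_le_zeroCount hc.period_pos himage.periodic_u himage.periodic_w
      (himage.zerosSeparatedBy_quasiDeriv hc) hZ hx hWx).trans
      ((himage.zeroCount_quasiDeriv_le hc).trans (zeroCount_sum_le hc hU hind hM hlam))
    exact absurd hle (by exact_mod_cast Nat.not_succ_le_self Z.card)

end SimpleZeros

end Chebyshev

section WeightedForm

/-- The bilinear form `∫ f g r` over `[0, T]` on continuous functions. -/
noncomputable def weightedForm (T : ℝ) (r : C(ℝ, ℝ)) : LinearMap.BilinForm ℝ C(ℝ, ℝ) :=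
  LinearMap.mk₂ ℝ (fun f g => ∫ x in (0 : ℝ)..T, f x * g x * r x)
    (fun f₁ f₂ g => by
      rw [← intervalIntegral.integral_add (Continuous.intervalIntegrable (by fun_prop) _ _)
        (Continuous.intervalIntegrable (by fun_prop) _ _)]
      simp only [ContinuousMap.add_apply, add_mul])
    (fun a f g => by
      rw [smul_eq_mul, ← intervalIntegral.integral_const_mul]
      simp only [ContinuousMap.smul_apply, smul_eq_mul, mul_assoc])
    (fun f g₁ g₂ => by
      rw [← intervalIntegral.integral_add (Continuous.intervalIntegrable (by fun_prop) _ _)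
        (Continuous.intervalIntegrable (by fun_prop) _ _)]
      simp only [ContinuousMap.add_apply, mul_add, add_mul])
    (fun a f g => by
      rw [smul_eq_mul, ← intervalIntegral.integral_const_mul]
      simp only [ContinuousMap.smul_apply, smul_eq_mul, mul_assoc, mul_left_comm])

lemma weightedForm_apply (T : ℝ) (r f g : C(ℝ, ℝ)) :
    weightedForm T r f g = ∫ x in (0 : ℝ)..T, f x * g x * r x := rfl

lemma isSymm_weightedForm (T : ℝ) (r : C(ℝ, ℝ)) : LinearMap.IsSymm (weightedForm T r) :=
  ⟨fun f g => by simp only [weightedForm_apply, mul_comm (f _), RingHom.id_apply]⟩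

lemma weightedForm_self_nonneg {T : ℝ} (hT : 0 ≤ T) {r : C(ℝ, ℝ)} (hr : ∀ x, 0 ≤ r x)
    (f : C(ℝ, ℝ)) : 0 ≤ weightedForm T r f f :=
  intervalIntegral.integral_nonneg hT fun x _ => mul_nonneg (mul_self_nonneg _) (hr x)

lemma linearIndependent_of_integral_mul_eq_zero {ι : Type*} {T : ℝ} {r : ℝ → ℝ}
    (hr : Continuous r) {U : ι → ℝ → ℝ} (hU : ∀ i, Continuous (U i))
    (horth : ∀ i j, i ≠ j → ∫ x in (0 : ℝ)..T, U i x * U j x * r x = 0)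
    (hself : ∀ i, ∫ x in (0 : ℝ)..T, U i x * U i x * r x ≠ 0) : LinearIndependent ℝ U :=
  (LinearMap.linearIndependent_of_isOrthoᵢ (B := weightedForm T ⟨r, hr⟩)
    (v := fun i => ⟨U i, hU i⟩) (fun i j hij => horth i j hij) hself).map'
    (ContinuousMap.coeFnLinearMap ℝ) (LinearMap.ker_eq_bot.2 DFunLike.coe_injective)

lemma form_eq_zero_of_tendsto {V κ : Type*} [AddCommGroup V] [Module ℝ V] {l : Filter κ} [l.NeBot]
    {B : LinearMap.BilinForm ℝ V} (hsymm : LinearMap.IsSymm B) (hnonneg : ∀ x, 0 ≤ B x x) {f g : V}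
    {S : κ → V} (hS : ∀ n, B (S n) g = 0)
    (hlim : Tendsto (fun n => B (f - S n) (f - S n)) l (𝓝 0)) : B f g = 0 := by
  have hle : ∀ n, B f g ^ 2 ≤ B (f - S n) (f - S n) * B g g := fun n => by
    simpa [hS n] using B.apply_sq_le_of_symm hnonneg hsymm (f - S n) g
  have hsq : B f g ^ 2 ≤ 0 :=
    ge_of_tendsto (by simpa using hlim.mul_const (B g g)) (.of_forall hle)
  exact pow_eq_zero_iff two_ne_zero |>.1 (hsq.antisymm (sq_nonneg _))

end WeightedForm

section SignChanges

/-- `f` does not change sign at `x`: near `x` it is nonnegative or it is nonpositive. -/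
def LocallyOneSigned (f : ℝ → ℝ) (x : ℝ) : Prop :=
  (∀ᶠ y in 𝓝 x, 0 ≤ f y) ∨ ∀ᶠ y in 𝓝 x, f y ≤ 0

/-- The points of the period `[0, T)` at which `f` changes sign. -/
def signChanges (T : ℝ) (f : ℝ → ℝ) : Set ℝ := {x ∈ Ico 0 T | ¬LocallyOneSigned f x}

/-- The zeros of `f` do not accumulate. -/
def HasIsolatedZeros (f : ℝ → ℝ) : Prop := ∀ x, ∀ᶠ y in 𝓝[≠] x, f y ≠ 0

/-- `f` has a nonzero derivative at each of its zeros. Differentiability there is part of the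
condition, since `deriv` is `0` where it fails. -/
def HasSimpleZeros (f : ℝ → ℝ) : Prop := ∀ x, f x = 0 → deriv f x ≠ 0

variable {f g : ℝ → ℝ} {x T : ℝ}

lemma locallyOneSigned_of_ne_zero (hf : ContinuousAt f x) (h : f x ≠ 0) :
    LocallyOneSigned f x := by
  rcases h.lt_or_gt with h | h
  · exact Or.inr ((hf.eventually_lt continuousAt_const h).mono fun _ => le_of_lt)
  · exact Or.inl ((continuousAt_const.eventually_lt hf h).mono fun _ => le_of_lt)

lemma LocallyOneSigned.mul (hf : LocallyOneSigned f x) (hg : LocallyOneSigned g x) :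
    LocallyOneSigned (fun y => f y * g y) x := by
  rcases hf with hf | hf <;> rcases hg with hg | hg
  · exact Or.inl (hf.and hg |>.mono fun _ h => mul_nonneg h.1 h.2)
  · exact Or.inr (hf.and hg |>.mono fun _ h => mul_nonpos_of_nonneg_of_nonpos h.1 h.2)
  · exact Or.inr (hf.and hg |>.mono fun _ h => mul_nonpos_of_nonpos_of_nonneg h.1 h.2)
  · exact Or.inl (hf.and hg |>.mono fun _ h => mul_nonneg_of_nonpos_of_nonpos h.1 h.2)

lemma locallyOneSigned_add_zsmul (hf : Function.Periodic f T) (n : ℤ) :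
    LocallyOneSigned f (x + n • T) ↔ LocallyOneSigned f x := by
  simp only [LocallyOneSigned, ← map_add_right_nhds (n • T) x, eventually_map, (hf.zsmul n) _]

lemma toIcoMod_mem_signChanges_iff (hT : 0 < T) (hf : Function.Periodic f T) :
    toIcoMod hT 0 x ∈ signChanges T f ↔ ¬LocallyOneSigned f x := by
  conv_rhs => rw [← toIcoMod_add_toIcoDiv_zsmul hT 0 x, locallyOneSigned_add_zsmul hf]
  exact and_iff_right (by simpa using toIcoMod_mem_Ico hT 0 x)

lemma nonneg_or_nonpos_of_ne_zero {s : Set ℝ} (hs : IsPreconnected s) (hf : ContinuousOn f s)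
    (h : ∀ y ∈ s, f y ≠ 0) : (∀ y ∈ s, 0 ≤ f y) ∨ ∀ y ∈ s, f y ≤ 0 := by
  by_contra! hcon
  obtain ⟨⟨a, ha, ha0⟩, b, hb, hb0⟩ := hcon
  obtain ⟨c, hc, hc0⟩ := hs.intermediate_value ha hb hf ⟨ha0.le, hb0.le⟩
  exact h c hc hc0

lemma locallyOneSigned_mul_sub (hf : Continuous f) (hiso : HasIsolatedZeros f)
    (hsign : ¬LocallyOneSigned f x) : LocallyOneSigned (fun y => f y * (y - x)) x := by
  have hfx : f x = 0 := by_contra fun h => hsign (locallyOneSigned_of_ne_zero hf.continuousAt h)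
  obtain ⟨δ, hδ, hball⟩ := Metric.eventually_nhds_iff_ball.1 (eventually_nhdsWithin_iff.1 (hiso x))
  rw [Real.ball_eq_Ioo] at hball
  have hleft := nonneg_or_nonpos_of_ne_zero (isPreconnected_Ioo (a := x - δ) (b := x))
    hf.continuousOn fun y hy => hball y ⟨hy.1, by linarith [hy.2]⟩ hy.2.ne
  have hright := nonneg_or_nonpos_of_ne_zero (isPreconnected_Ioo (a := x) (b := x + δ))
    hf.continuousOn fun y hy => hball y ⟨by linarith [hy.1], hy.2⟩ hy.1.ne'
  have hglue : ∀ P : ℝ → Prop, (∀ y ∈ Ioo (x - δ) x, P y) → P x →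
      (∀ y ∈ Ioo x (x + δ), P y) → ∀ᶠ y in 𝓝 x, P y := by
    intro P hl hx hr
    filter_upwards [Ioo_mem_nhds (sub_lt_self x hδ) (lt_add_of_pos_right x hδ)] with y hy
    rcases lt_trichotomy y x with h | rfl | h
    exacts [hl y ⟨hy.1, h⟩, hx, hr y ⟨h, hy.2⟩]
  rcases hleft with hl | hl <;> rcases hright with hr | hr
  · exact absurd (Or.inl (hglue _ hl hfx.ge hr)) hsign
  · exact Or.inr (hglue _
      (fun y hy => mul_nonpos_of_nonneg_of_nonpos (hl y hy) (sub_nonpos.2 hy.2.le)) (by simp)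
      fun y hy => mul_nonpos_of_nonpos_of_nonneg (hr y hy) (sub_nonneg.2 hy.1.le))
  · exact Or.inl (hglue _
      (fun y hy => mul_nonneg_of_nonpos_of_nonpos (hl y hy) (sub_nonpos.2 hy.2.le)) (by simp)
      fun y hy => mul_nonneg (hr y hy) (sub_nonneg.2 hy.1.le))
  · exact absurd (Or.inr (hglue _ hl hfx.le hr)) hsign

lemma locallyOneSigned_mul_of_simple_zero (hf : LocallyOneSigned (fun y => f y * (y - x)) x)
    (hg : g x = 0) (hg' : deriv g x ≠ 0) : LocallyOneSigned (fun y => f y * g y) x := by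
  have hslope : LocallyOneSigned (dslope g x) x := locallyOneSigned_of_ne_zero
    (continuousAt_dslope_same.2 (differentiableAt_of_deriv_ne_zero hg')) (by simpa using hg')
  have hfactor : ∀ y, f y * g y = f y * (y - x) * dslope g x y := fun y => by
    rw [mul_assoc, ← smul_eq_mul (y - x), sub_smul_dslope, hg, sub_zero]
  simpa only [hfactor] using hf.mul hslope

lemma HasSimpleZeros.hasIsolatedZeros (hg : Continuous g) (h : HasSimpleZeros g) :
    HasIsolatedZeros g := by
  intro x
  by_cases hx : g x = 0
  · exact (differentiableAt_of_deriv_ne_zero (h x hx)).hasDerivAt.eventually_ne (h x hx)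
  · exact nhdsWithin_le_nhds (hg.continuousAt.eventually_ne hx)

lemma HasIsolatedZeros.mul (hf : HasIsolatedZeros f) (hg : HasIsolatedZeros g) :
    HasIsolatedZeros fun y => f y * g y :=
  fun x => ((hf x).and (hg x)).mono fun _ h => mul_ne_zero h.1 h.2

lemma HasIsolatedZeros.exists_ne_zero (hf : HasIsolatedZeros f) : ∃ y, f y ≠ 0 :=
  (hf 0).exists

lemma nonneg_or_nonpos_of_locallyOneSigned (h : ∀ x, LocallyOneSigned f x)
    (hiso : HasIsolatedZeros f) : (∀ x, 0 ≤ f x) ∨ ∀ x, f x ≤ 0 := by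
  have hpos : IsOpen {x | ∀ᶠ y in 𝓝 x, 0 ≤ f y} := isOpen_setOfPred_eventually_nhds
  have hneg : IsOpen {x | ∀ᶠ y in 𝓝 x, f y ≤ 0} := isOpen_setOfPred_eventually_nhds
  have hdisj : Disjoint {x | ∀ᶠ y in 𝓝 x, 0 ≤ f y} {x | ∀ᶠ y in 𝓝 x, f y ≤ 0} := by
    refine disjoint_left.2 fun x hx hx' => ?_
    obtain ⟨y, hy, hy0⟩ := (((hx.and hx').filter_mono nhdsWithin_le_nhds).and (hiso x)).exists
    exact hy0 (hy.2.antisymm hy.1)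
  exact (isPreconnected_univ.subset_or_subset hpos hneg hdisj fun x _ => h x).imp
    (fun h x => (h (mem_univ x)).self_of_nhds) fun h x => (h (mem_univ x)).self_of_nhds

lemma mul_nonneg_or_nonpos_of_zeros_eq_signChanges (hf : Continuous f) (hiso : HasIsolatedZeros f)
    (hg : Continuous g) (hsimple : HasSimpleZeros g)
    (hzeros : ∀ x, g x = 0 ↔ ¬LocallyOneSigned f x) :
    (∀ x, 0 ≤ f x * g x) ∨ ∀ x, f x * g x ≤ 0 := by
  refine nonneg_or_nonpos_of_locallyOneSigned (fun x => ?_)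
    (hiso.mul (hsimple.hasIsolatedZeros hg))
  by_cases hx : g x = 0
  · exact locallyOneSigned_mul_of_simple_zero
      (locallyOneSigned_mul_sub hf hiso ((hzeros x).1 hx)) hx (hsimple x hx)
  · exact (not_not.1 (mt (hzeros x).2 hx)).mul (locallyOneSigned_of_ne_zero hg.continuousAt hx)

lemma hasIsolatedZeros_of_zeroCount_ne_top (hT : 0 < T) (hf : Function.Periodic f T)
    (hfin : zeroCount T f ≠ ⊤) : HasIsolatedZeros f := by
  intro x
  obtain ⟨a, ha⟩ : ∃ a, a = x - T / 2 := ⟨_, rfl⟩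
  have hfin_a : {y ∈ Ico a (a + T) | f y = 0}.Finite := by
    refine Finite.of_injOn (f := toIcoMod hT 0) (fun y hy => ?_) (fun y hy z hz hyz => ?_)
      (encard_ne_top_iff.1 hfin)
    · exact ⟨by simpa using toIcoMod_mem_Ico hT 0 y, (hf.sub_zsmul_eq _).trans hy.2⟩
    · rw [← (toIcoMod_eq_self hT).2 hy.1, ← (toIcoMod_eq_self hT).2 hz.1,
        ← toIcoMod_toIcoMod hT a 0 y, hyz, toIcoMod_toIcoMod]
  have hIco : Ico a (a + T) ∈ 𝓝 x := Ico_mem_nhds (by linarith) (by linarith)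
  filter_upwards [nhdsWithin_le_nhds hIco, nhdsWithin_le_nhds
    ((hfin_a.subset sdiff_subset).isClosed.isOpen_compl.mem_nhds fun h : x ∈ _ \ {x} => h.2 rfl),
    self_mem_nhdsWithin] with y hy hy' hyx hy0
  exact hy' ⟨⟨hy, hy0⟩, hyx⟩

end SignChanges

section Parity

variable {T t x : ℝ} {f : ℝ → ℝ}

lemma hasSimpleZeros_prod {ι : Type*} {S : Finset ι} {F : ι → ℝ → ℝ}
    (hF : ∀ i ∈ S, Differentiable ℝ (F i)) (hsimple : ∀ i ∈ S, HasSimpleZeros (F i))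
    (hdisj : ∀ i ∈ S, ∀ j ∈ S, ∀ x, F i x = 0 → F j x = 0 → i = j) :
    HasSimpleZeros fun x => ∏ i ∈ S, F i x := by
  classical
  intro x hx
  obtain ⟨i, hi, hix⟩ := Finset.prod_eq_zero_iff.1 hx
  have hderiv := HasDerivAt.fun_finsetProd fun i hi => (hF i hi x).hasDerivAt
  rw [hderiv.deriv, Finset.sum_eq_single_of_mem i hi fun j _ hj => ?_]
  · refine smul_ne_zero (Finset.prod_ne_zero_iff.2 fun j hj hjx => ?_) (hsimple i hi x hix)
    exact Finset.ne_of_mem_erase hj (hdisj j (Finset.mem_of_mem_erase hj) i hi x hjx hix)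
  · rw [Finset.prod_eq_zero (Finset.mem_erase.2 ⟨hj.symm, hi⟩) hix, zero_smul]

lemma sin_pi_mul_sub_div_eq_zero_iff (hT : T ≠ 0) :
    Real.sin (π * (x - t) / T) = 0 ↔ ∃ n : ℤ, x = t + n • T := by
  rw [Real.sin_eq_zero_iff]
  refine exists_congr fun n => ?_
  rw [mul_comm (n : ℝ), mul_div_assoc, mul_right_inj' Real.pi_ne_zero, eq_div_iff hT,
    zsmul_eq_mul, ← sub_eq_iff_eq_add', eq_comm]

lemma hasSimpleZeros_sin_pi_mul_sub_div (hT : T ≠ 0) (t : ℝ) :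
    HasSimpleZeros fun x => Real.sin (π * (x - t) / T) := by
  intro x hx
  have hderiv : HasDerivAt (fun x => Real.sin (π * (x - t) / T))
      (Real.cos (π * (x - t) / T) * (π * 1 / T)) x :=
    ((((hasDerivAt_id x).sub_const t).const_mul π).div_const T).sin
  rw [hderiv.deriv]
  refine mul_ne_zero (fun hcos => ?_) (by simp [hT, Real.pi_ne_zero])
  simpa [hx, hcos] using Real.sin_sq_add_cos_sq (π * (x - t) / T)

lemma sin_pi_mul_sub_div_antiperiodic (hT : T ≠ 0) (t : ℝ) :
    Function.Antiperiodic (fun x => Real.sin (π * (x - t) / T)) T := fun x => by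
  have hshift : π * (x + T - t) / T = π * (x - t) / T + π := by field_simp; ring
  simp only [hshift, Real.sin_add_pi]

lemma eq_zero_of_antiperiodic_of_oneSigned {g : ℝ → ℝ} (hg : Function.Antiperiodic g T)
    (hsign : (∀ x, 0 ≤ g x) ∨ ∀ x, g x ≤ 0) (x : ℝ) : g x = 0 := by
  have hx := hg x
  rcases hsign with h | h <;> linarith [h x, h (x + T)]

/-- If there were an odd number of sign changes, `f` times the antiperiodic function
`∏ sin (π (x - z) / T)` would be both antiperiodic and of one sign. -/
theorem even_card_of_eq_signChanges (hT : 0 < T) (hf : Continuous f) (hper : Function.Periodic f T)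
    (hiso : HasIsolatedZeros f) {Z : Finset ℝ} (hZ : (Z : Set ℝ) = signChanges T f) :
    Even Z.card := by
  let σ (z x : ℝ) : ℝ := Real.sin (π * (x - z) / T)
  have hσ_diff : ∀ z, Differentiable ℝ (σ z) := fun z => by fun_prop
  have hσ_zero : ∀ z ∈ Z, ∀ x, σ z x = 0 ↔ toIcoMod hT 0 x = z := fun z hz x =>
    (sin_pi_mul_sub_div_eq_zero_iff hT.ne').trans
      (toIcoMod_zero_eq_iff hT (hZ.subset hz).1).symm
  have hprod_zero : ∀ x, ∏ z ∈ Z, σ z x = 0 ↔ ¬LocallyOneSigned f x := fun x => by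
    rw [← toIcoMod_mem_signChanges_iff hT hper, ← hZ, Finset.mem_coe, Finset.prod_eq_zero_iff]
    exact ⟨fun ⟨z, hz, hx⟩ => (hσ_zero z hz x).1 hx ▸ hz, fun h => ⟨_, h, (hσ_zero _ h x).2 rfl⟩⟩
  have hsimple : HasSimpleZeros fun x => ∏ z ∈ Z, σ z x :=
    hasSimpleZeros_prod (fun z _ => hσ_diff z)
      (fun z _ => hasSimpleZeros_sin_pi_mul_sub_div hT.ne' z)
      fun z hz z' hz' x hx hx' => ((hσ_zero z hz x).1 hx).symm.trans ((hσ_zero z' hz' x).1 hx')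
  have hcont : Continuous fun x => ∏ z ∈ Z, σ z x :=
    continuous_finsetProd Z fun z _ => (hσ_diff z).continuous
  by_contra hodd
  have hanti : Function.Antiperiodic (fun x => f x * ∏ z ∈ Z, σ z x) T := fun x => by
    simp only [hper x, fun z => sin_pi_mul_sub_div_antiperiodic hT.ne' z x, σ, Finset.prod_neg,
      (Nat.not_even_iff_odd.1 hodd).neg_one_pow, neg_one_mul, mul_neg]
  obtain ⟨y, hy⟩ := (hiso.mul (hsimple.hasIsolatedZeros hcont)).exists_ne_zero
  exact hy (eq_zero_of_antiperiodic_of_oneSigned hanti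
    (mul_nonneg_or_nonpos_of_zeros_eq_signChanges hf hiso hcont hsimple hprod_zero) y)

end Parity
section Nonorthogonality

variable {T : ℝ} {r s : ℝ → ℝ}

lemma integral_ne_zero_of_oneSigned (hT : 0 < T) {f : ℝ → ℝ} (hf : Continuous f)
    (hper : Function.Periodic f T) (hsign : (∀ x, 0 ≤ f x) ∨ ∀ x, f x ≤ 0) (hne : f ≠ 0) :
    ∫ x in (0 : ℝ)..T, f x ≠ 0 := by
  intro h0
  rcases hsign with h | h
  · exact hne (eq_zero_of_integral_eq_zero hT hf hper h h0)
  · exact hne (neg_eq_zero.1 (eq_zero_of_integral_eq_zero hT hf.neg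
      (fun x => congrArg Neg.neg (hper x)) (fun x => neg_nonneg.2 (h x)) (by simp [h0])))

lemma integral_mul_sum_eq {ι : Type*} {S : Finset ι} {f r : ℝ → ℝ} (hf : Continuous f)
    (hr : Continuous r) {U : ι → ℝ → ℝ} (hU : ∀ i ∈ S, Continuous (U i)) (c : ι → ℝ) :
    ∫ x in (0 : ℝ)..T, f x * (∑ i ∈ S, c i • U i) x * r x =
      ∑ i ∈ S, c i * ∫ x in (0 : ℝ)..T, f x * U i x * r x := by
  simp only [← intervalIntegral.integral_const_mul]
  rw [← intervalIntegral.integral_finsetSum fun i hi => ?_]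
  · simp only [Finset.sum_apply, Pi.smul_apply, smul_eq_mul, Finset.mul_sum, Finset.sum_mul,
      mul_assoc, mul_left_comm]
  · have := hU i hi
    exact Continuous.intervalIntegrable (by fun_prop) _ _

/-- The `U i` have a combination vanishing at the sign changes of `f`; it vanishes only there and
changes sign there, so its product with `f` is of one sign. -/
theorem exists_integral_mul_ne_zero {ι : Type*} [Fintype ι] {lam : ι → ℝ} {U W : ι → ℝ → ℝ}
    (hc : IsCoefficients T r s) (hU : ∀ i, IsEigen T r s (lam i) (U i) (W i))
    (hind : LinearIndependent ℝ U) {f : ℝ → ℝ} (hf : Continuous f) (hper : Function.Periodic f T)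
    (hiso : HasIsolatedZeros f) {Z : Finset ℝ} (hZ : (Z : Set ℝ) = signChanges T f)
    (hcard : Z.card < Fintype.card ι) (hM : ∀ i, zeroCount T (U i) ≤ Z.card) :
    ∃ i, ∫ x in (0 : ℝ)..T, f x * U i x * r x ≠ 0 := by
  obtain ⟨c, hne, hvanish⟩ := exists_ne_zero_vanishing U Z hcard
  have hZ0 : ∀ z ∈ Z, z ∈ Ico 0 T ∧ (∑ i, c i • U i) z = 0 := fun z hz =>
    ⟨(hZ.subset hz).1, hvanish z hz⟩
  have himage := IsImage.sum (S := Finset.univ) (fun i _ => hU i) c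
  have hg := himage.continuous_u
  have hr := hc.continuous_r
  have hmem : ∀ x, (∑ i, c i • U i) x = 0 ↔ toIcoMod hc.period_pos 0 x ∈ Z := fun x => by
    rw [← himage.periodic_u.sub_zsmul_eq (toIcoDiv hc.period_pos 0 x)]
    exact ⟨mem_of_zeroCount_le_card hc hU hind hM hne hZ0
      (by simpa using toIcoMod_mem_Ico hc.period_pos 0 x), hvanish _⟩
  have hsimple : HasSimpleZeros (∑ i, c i • U i) := fun x hx => by
    rw [(himage.hasDerivAt_u x).deriv,
      ← himage.periodic_w.sub_zsmul_eq (toIcoDiv hc.period_pos 0 x)]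
    exact mul_ne_zero (hc.pos_s x).ne'
      (quasiDeriv_sum_ne_zero hc hU hind hM hne hZ0 ((hmem x).1 hx))
  have hsign := mul_nonneg_or_nonpos_of_zeros_eq_signChanges hf hiso hg hsimple fun x => by
    rw [hmem, ← toIcoMod_mem_signChanges_iff hc.period_pos hper, ← hZ, Finset.mem_coe]
  obtain ⟨y, hy⟩ := (hiso.mul (hsimple.hasIsolatedZeros hg)).exists_ne_zero
  have hint := integral_ne_zero_of_oneSigned hc.period_pos
    (f := fun x => f x * (∑ i, c i • U i) x * r x) (by fun_prop)
    (fun x => by simp only [hper x, himage.periodic_u x, hc.periodic_r x])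
    (hsign.imp (fun h x => mul_nonneg (h x) (hc.pos_r x).le)
      fun h x => mul_nonpos_of_nonpos_of_nonneg (h x) (hc.pos_r x).le)
    (Function.ne_iff.2 ⟨y, mul_ne_zero hy (hc.pos_r y).ne'⟩)
  by_contra! hzero
  exact hint (by rw [integral_mul_sum_eq hf hr fun i _ => (hU i).continuous_u]; simp [hzero])

end Nonorthogonality

section Angle

variable {r s u w : ℝ → ℝ} {T lam : ℝ}

lemma exists_mul_cos_eq_mul_sin (a b : ℝ) : ∃ φ : ℝ, a * Real.cos φ = b * Real.sin φ := by
  by_cases hz : (⟨b, a⟩ : ℂ) = 0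
  · obtain ⟨hb, ha⟩ := Complex.ext_iff.1 hz
    exact ⟨0, by simp_all⟩
  · refine ⟨Complex.arg ⟨b, a⟩, ?_⟩
    rw [Complex.cos_arg hz, Complex.sin_arg]
    ring

/-- The derivative of the clockwise angle `φ` of the plane curve `(u, w)`, where
`(u, w) = ρ (sin φ, cos φ)`. -/
noncomputable def angularSpeed (u w : ℝ → ℝ) (x : ℝ) : ℝ :=
  (w x * deriv u x - u x * deriv w x) / (u x ^ 2 + w x ^ 2)

lemma mul_cos_eq_mul_sin_of_hasDerivAt_angularSpeed {φ : ℝ → ℝ} (hu : Differentiable ℝ u)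
    (hw : Differentiable ℝ w) (hne : ∀ x, u x ^ 2 + w x ^ 2 ≠ 0)
    (hφ : ∀ x, HasDerivAt φ (angularSpeed u w x) x) {x₀ : ℝ}
    (h₀ : u x₀ * Real.cos (φ x₀) = w x₀ * Real.sin (φ x₀)) (x : ℝ) :
    u x * Real.cos (φ x) = w x * Real.sin (φ x) := by
  let D (x : ℝ) : ℝ := (u x * Real.cos (φ x) - w x * Real.sin (φ x)) ^ 2 / (u x ^ 2 + w x ^ 2)
  have hD : ∀ x, HasDerivAt D 0 x := fun x => by
    have hquot := (((((hu x).hasDerivAt.mul (hφ x).cos).sub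
      ((hw x).hasDerivAt.mul (hφ x).sin)).pow 2).div
      (((hu x).hasDerivAt.pow 2).add ((hw x).hasDerivAt.pow 2)) (hne x))
    refine hquot.congr_deriv ?_
    have := hne x
    simp only [Pi.sub_apply, Pi.mul_apply, Pi.add_apply, Pi.pow_apply, angularSpeed]
    field_simp
    ring
  have hconst := is_const_of_deriv_eq_zero (fun x => (hD x).differentiableAt)
    (fun x => (hD x).deriv) x x₀
  simpa [D, h₀, hne x, sub_eq_zero] using hconst

lemma eq_zero_iff_sin_eq_zero {a b φ : ℝ} (hne : a ^ 2 + b ^ 2 ≠ 0)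
    (h : a * Real.cos φ = b * Real.sin φ) : a = 0 ↔ Real.sin φ = 0 := by
  constructor
  · rintro rfl
    rw [zero_mul, zero_eq_mul] at h
    exact h.resolve_left fun hb => hne (by simp [hb])
  · intro hsin
    rw [hsin, mul_zero] at h
    exact (mul_eq_zero.1 h).resolve_right fun hcos => by
      simpa [hsin, hcos] using Real.sin_sq_add_cos_sq φ

lemma zeroCount_sin_comp {φ : ℝ → ℝ} (hT : 0 ≤ T) (hφ : StrictMono φ) (hcont : Continuous φ)
    {k : ℕ} (hk : φ T = φ 0 + k * π) : zeroCount T (fun x => Real.sin (φ x)) = k := by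
  let N : Finset ℤ := Finset.Ico ⌈φ 0 / π⌉ ⌈φ T / π⌉
  have hN : ∀ n : ℤ, n ∈ N ↔ φ 0 ≤ n * π ∧ n * π < φ T := fun n => by
    rw [Finset.mem_Ico, Int.ceil_le, Int.lt_ceil, div_le_iff₀ Real.pi_pos, lt_div_iff₀ Real.pi_pos]
  have himage : (fun n : ℤ => n * π) '' N = φ '' {x ∈ Ico 0 T | Real.sin (φ x) = 0} := by
    ext y
    constructor
    · rintro ⟨n, hn, rfl⟩
      obtain ⟨h0, h1⟩ := (hN n).1 hn
      obtain ⟨x, hx, hxn⟩ := intermediate_value_Ico hT hcont.continuousOn ⟨h0, h1⟩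
      exact ⟨x, ⟨hx, hxn ▸ Real.sin_int_mul_pi n⟩, hxn⟩
    · rintro ⟨x, ⟨hx, hsin⟩, rfl⟩
      obtain ⟨n, hn⟩ := Real.sin_eq_zero_iff.1 hsin
      exact ⟨n, (hN n).2 (hn ▸ ⟨hφ.monotone hx.1, hφ hx.2⟩), hn⟩
  have hinj : Function.Injective fun n : ℤ => (n : ℝ) * π :=
    (mul_left_injective₀ Real.pi_ne_zero).comp Int.cast_injective
  have hcard : N.card = k := by
    have hdiv : φ T / π = φ 0 / π + k := by rw [hk]; field_simp
    simp [N, hdiv]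
  rw [zeroCount, ← hφ.injective.encard_image, ← himage, hinj.encard_image,
    encard_coe_eq_coe_finsetCard, hcard]

namespace IsEigen

lemma sq_add_sq_ne_zero (hc : IsCoefficients T r s) (h : IsEigen T r s lam u w) (hne : u ≠ 0)
    (x : ℝ) : u x ^ 2 + w x ^ 2 ≠ 0 := fun h0 => by
  rw [add_eq_zero_iff_of_nonneg (sq_nonneg _) (sq_nonneg _), sq_eq_zero_iff, sq_eq_zero_iff] at h0
  exact h.quasiDeriv_ne_zero hc hne h0.1 h0.2

lemma angularSpeed_eq (h : IsEigen T r s lam u w) (x : ℝ) :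
    angularSpeed u w x = (s x * w x ^ 2 + lam * r x * u x ^ 2) / (u x ^ 2 + w x ^ 2) := by
  rw [angularSpeed, (h.hasDerivAt_u x).deriv, (h.hasDerivAt_w x).deriv, Pi.smul_apply, smul_eq_mul]
  ring

lemma continuous_angularSpeed (hc : IsCoefficients T r s) (h : IsEigen T r s lam u w)
    (hne : u ≠ 0) : Continuous (angularSpeed u w) := by
  have hr := hc.continuous_r
  have hs := hc.continuous_s
  have hu := h.continuous_u
  have hw := h.continuous_w
  rw [funext h.angularSpeed_eq]
  exact Continuous.div (by fun_prop) (by fun_prop) (h.sq_add_sq_ne_zero hc hne)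

lemma angularSpeed_pos (hc : IsCoefficients T r s) (h : IsEigen T r s lam u w) (hne : u ≠ 0)
    (hlam : 0 < lam) (x : ℝ) : 0 < angularSpeed u w x := by
  have hr := hc.pos_r x
  have hs := hc.pos_s x
  rw [h.angularSpeed_eq]
  by_cases hu : u x = 0
  · have hw := h.quasiDeriv_ne_zero hc hne hu
    positivity
  · positivity

lemma zeroCount_eq (hc : IsCoefficients T r s) (h : IsEigen T r s lam u w) (hne : u ≠ 0)
    (hlam : 0 < lam) {k : ℕ} (hk : ∫ x in (0 : ℝ)..T, angularSpeed u w x = k * π) :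
    zeroCount T u = k := by
  obtain ⟨φ₀, hφ₀⟩ := exists_mul_cos_eq_mul_sin (u 0) (w 0)
  let φ (x : ℝ) : ℝ := φ₀ + ∫ t in (0 : ℝ)..x, angularSpeed u w t
  have hφ : ∀ x, HasDerivAt φ (angularSpeed u w x) x := fun x =>
    ((h.continuous_angularSpeed hc hne).integral_hasStrictDerivAt 0 x).hasDerivAt.const_add φ₀
  have hangle := mul_cos_eq_mul_sin_of_hasDerivAt_angularSpeed
    (fun x => (h.hasDerivAt_u x).differentiableAt) (fun x => (h.hasDerivAt_w x).differentiableAt)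
    (h.sq_add_sq_ne_zero hc hne) hφ (x₀ := 0) (by simpa [φ] using hφ₀)
  rw [zeroCount_congr fun x =>
    eq_zero_iff_sin_eq_zero (h.sq_add_sq_ne_zero hc hne x) (hangle x)]
  exact zeroCount_sin_comp hc.period_pos.le
    (strictMono_of_hasDerivAt_pos hφ (h.angularSpeed_pos hc hne hlam))
    (continuous_iff_continuousAt.2 fun x => (hφ x).continuousAt) (by simp [φ, hk])

end IsEigen

end Angle

end SturmLiouville

namespace MinkowskiPlane

open SturmLiouville Set
open scoped Real

section UnitCircle

variable {N : Seminorm ℝ (ℝ × ℝ)} {p : ℝ → ℝ × ℝ}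

lemma periodic_deriv {F : Type*} [NormedAddCommGroup F] [NormedSpace ℝ F] {f : ℝ → F} {c : ℝ}
    (hf : Function.Periodic f c) : Function.Periodic (deriv f) c := fun x => by
  rw [← deriv_comp_add_const, show (fun x => f (x + c)) = f from funext hf]

lemma hasDerivAt_fst {f : ℝ → ℝ × ℝ} {f' : ℝ × ℝ} {x : ℝ} (h : HasDerivAt f f' x) :
    HasDerivAt (fun t => (f t).1) f'.1 x := by
  simpa using h.hasFDerivAt.fst.hasDerivAt

lemma hasDerivAt_snd {f : ℝ → ℝ × ℝ} {f' : ℝ × ℝ} {x : ℝ} (h : HasDerivAt f f' x) :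
    HasDerivAt (fun t => (f t).2) f'.2 x := by
  simpa using h.hasFDerivAt.snd.hasDerivAt

lemma hasDerivAt_det {f g : ℝ → ℝ × ℝ} {f' g' : ℝ × ℝ} {x : ℝ} (hf : HasDerivAt f f' x)
    (hg : HasDerivAt g g' x) :
    HasDerivAt (fun t => det (f t) (g t)) (det f' (g x) + det (f x) g') x :=
  (((hasDerivAt_fst hf).mul (hasDerivAt_snd hg)).sub
    ((hasDerivAt_snd hf).mul (hasDerivAt_fst hg))).congr_deriv (by simp only [det]; ring)

lemma continuous_det {f g : ℝ → ℝ × ℝ} (hf : Continuous f) (hg : Continuous g) :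
    Continuous fun t => det (f t) (g t) := by
  unfold det
  fun_prop

lemma weight_dual {x : ℝ} (hp : HasDerivAt p (deriv p x) x)
    (hp' : HasDerivAt (deriv p) (deriv (deriv p) x) x) (hne : weight p x ≠ 0) :
    weight (dual p) x = (weight p x)⁻¹ ^ 2 * det (deriv p x) (deriv (deriv p) x) := by
  have hweight : HasDerivAt (weight p) _ x := hasDerivAt_det hp hp'
  have hdual : HasDerivAt (dual p) _ x := (hweight.inv hne).smul hp'
  rw [weight, hdual.deriv, dual]
  simp only [det, Prod.fst_add, Prod.snd_add, Prod.smul_fst, Prod.smul_snd, smul_eq_mul,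
    Pi.inv_apply]
  ring

namespace IsUnitCircle

lemma hasDerivAt_p (hp : IsUnitCircle N p) (x : ℝ) : HasDerivAt p (deriv p x) x :=
  (hp.smooth.differentiable (by simp)).differentiableAt.hasDerivAt

lemma contDiff_deriv (hp : IsUnitCircle N p) : ContDiff ℝ ∞ (deriv p) :=
  (contDiff_infty_iff_deriv.1 hp.smooth).2

lemma hasDerivAt_deriv (hp : IsUnitCircle N p) (x : ℝ) :
    HasDerivAt (deriv p) (deriv (deriv p) x) x :=
  (hp.contDiff_deriv.differentiable (by simp)).differentiableAt.hasDerivAt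

lemma periodic (hp : IsUnitCircle N p) : Function.Periodic p (2 * π) := fun x => by
  rw [two_mul, ← add_assoc, hp.antipodal, hp.antipodal, neg_neg]

/-- The component of `p` transversal to the tangent direction at `x` decreases from `x` to `x + π`,
where it takes the opposite value. -/
lemma weight_pos (hp : IsUnitCircle N p) (x : ℝ) : 0 < weight p x := by
  obtain ⟨c, hc⟩ := hp.tangent
  choose ρ hρ htangent using hc
  let τ : ℝ × ℝ := (Real.cos (x + c), Real.sin (x + c))
  have hderiv : ∀ t, HasDerivAt (fun t => det (p t) τ) (ρ t * Real.sin (x - t)) t := fun t =>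
    (hasDerivAt_det (hp.hasDerivAt_p t) (hasDerivAt_const t τ)).congr_deriv <| by
      rw [htangent t, show x - t = (x + c) - (t + c) by ring, Real.sin_sub]
      simp only [det, τ, Prod.fst_zero, Prod.snd_zero]
      ring
  obtain ⟨t, ht, hslope⟩ := exists_hasDerivAt_eq_slope _ _ (lt_add_of_pos_right x Real.pi_pos)
    (fun t _ => (hderiv t).continuousAt.continuousWithinAt) fun t _ => hderiv t
  have hneg : ρ t * Real.sin (x - t) < 0 :=
    mul_neg_of_pos_of_neg (hρ t) (Real.sin_neg_of_neg_of_neg_pi_lt (by linarith [ht.1])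
      (by linarith [ht.2]))
  have hanti : det (p (x + π)) τ = -det (p x) τ := by
    rw [hp.antipodal]
    simp only [det, Prod.fst_neg, Prod.snd_neg]
    ring
  rw [hslope, hanti, add_sub_cancel_left, div_lt_iff₀ Real.pi_pos, zero_mul] at hneg
  have hweight : weight p x = ρ x * det (p x) τ := by
    rw [weight, htangent x]
    simp only [det, τ]
    ring
  rw [hweight]
  exact mul_pos (hρ x) (by linarith)

lemma det_deriv_pos (hp : IsUnitCircle N p) (x : ℝ) : 0 < det (deriv p x) (deriv (deriv p) x) := by
  obtain ⟨c, hc⟩ := hp.tangent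
  choose ρ hρ htangent using hc
  let τ (t : ℝ) : ℝ × ℝ := (Real.cos (t + c), Real.sin (t + c))
  have hτ : HasDerivAt τ (-Real.sin (x + c), Real.cos (x + c)) x := by
    have hid := (hasDerivAt_id x).add_const c
    exact (hid.cos.prodMk hid.sin).congr_deriv (by simp)
  have hparallel : (fun t => det (deriv p t) (τ t)) = fun _ => 0 := by
    funext t
    rw [htangent t]
    simp only [det, τ]
    ring
  have hderiv := hasDerivAt_det (hp.hasDerivAt_deriv x) hτ
  rw [hparallel] at hderiv
  have hcurv := hderiv.unique (hasDerivAt_const x 0)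
  have hsq : det (deriv p x) (deriv (deriv p) x) = ρ x ^ 2 := by
    rw [htangent x] at hcurv ⊢
    simp only [det, τ] at hcurv ⊢
    linear_combination -ρ x * hcurv + ρ x ^ 2 * Real.sin_sq_add_cos_sq (x + c)
  rw [hsq]
  exact pow_pos (hρ x) 2

lemma weight_dual_eq (hp : IsUnitCircle N p) : weight (dual p) =
    fun x => (weight p x)⁻¹ ^ 2 * det (deriv p x) (deriv (deriv p) x) :=
  funext fun x => weight_dual (hp.hasDerivAt_p x) (hp.hasDerivAt_deriv x) (hp.weight_pos x).ne'

lemma isCoefficients (hp : IsUnitCircle N p) :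
    IsCoefficients (2 * π) (weight p) (weight (dual p)) where
  period_pos := Real.two_pi_pos
  continuous_r := continuous_det hp.smooth.continuous hp.contDiff_deriv.continuous
  continuous_s := by
    rw [hp.weight_dual_eq]
    have hweight : Continuous (weight p) :=
      continuous_det hp.smooth.continuous hp.contDiff_deriv.continuous
    exact ((hweight.inv₀ fun x => (hp.weight_pos x).ne').pow 2).mul
      (continuous_det hp.contDiff_deriv.continuous
        (contDiff_infty_iff_deriv.1 hp.contDiff_deriv).2.continuous)
  pos_r := hp.weight_pos
  pos_s x := by
    rw [hp.weight_dual_eq]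
    exact mul_pos (pow_pos (inv_pos.2 (hp.weight_pos x)) 2) (hp.det_deriv_pos x)
  periodic_r x := by rw [weight, weight, hp.periodic x, periodic_deriv hp.periodic x]
  periodic_s x := by
    rw [hp.weight_dual_eq]
    simp only [weight, hp.periodic x, periodic_deriv hp.periodic x,
      periodic_deriv (periodic_deriv hp.periodic) x]

end IsUnitCircle

end UnitCircle

section Eigenfunctions

variable {p : ℝ → ℝ × ℝ} {lam : ℝ} {u v : ℝ → ℝ} {k : ℕ}

lemma IsEigenfunction.isEigen (hp : IsCoefficients (2 * π) (weight p) (weight (dual p)))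
    (h : IsEigenfunction p lam u) :
    IsEigen (2 * π) (weight p) (weight (dual p)) lam u (quasiDeriv p u) where
  hasDerivAt_u x := by
    rw [quasiDeriv, mul_div_cancel₀ _ (hp.pos_s x).ne']
    exact (h.isSolution.differentiable x).hasDerivAt
  hasDerivAt_w x := by
    refine (h.isSolution.differentiable_quasiDeriv x).hasDerivAt.congr_deriv ?_
    rw [(inv_mul_eq_iff_eq_mul₀ (hp.pos_r x).ne').1 (h.isSolution.eqn x), Pi.smul_apply,
      smul_eq_mul]
    ring
  periodic_u := h.periodic
  periodic_w x := by
    rw [quasiDeriv, quasiDeriv, periodic_deriv h.periodic x, hp.periodic_s x]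
  periodic_v x := congrArg (lam * ·) (h.periodic x)

lemma integral_angularSpeed_eq (hk : index p u = k) :
    ∫ x in (0 : ℝ)..(2 * π), angularSpeed u (quasiDeriv p u) x = (2 * k : ℕ) * π := by
  have hindex : 1 / (2 * π) * ∫ x in (0 : ℝ)..(2 * π), angularSpeed u (quasiDeriv p u) x = k := hk
  have := Real.pi_ne_zero
  field_simp at hindex
  rw [hindex]
  push_cast
  ring

lemma IsEigenfunction.eigenvalue_pos (hp : IsCoefficients (2 * π) (weight p) (weight (dual p)))
    (h : IsEigenfunction p lam u) (hk1 : 1 ≤ k) (hk : index p u = k) : 0 < lam := by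
  refine ((h.isEigen hp).nonneg hp h.ne_zero).lt_of_ne ?_
  rintro rfl
  have hw := (h.isEigen hp).quasiDeriv_eq_zero hp
  have hzero : index p u = 0 := by simp [index, hw]
  exact absurd (Nat.cast_eq_zero.1 (hk.symm.trans hzero)) (by omega)

lemma eigenvalue_pos_of_mem (hp : IsCoefficients (2 * π) (weight p) (weight (dual p)))
    (hk1 : 1 ≤ k) (hlam : lam ∈ eigenvaluesOfIndex p k) : 0 < lam := by
  obtain ⟨u, hu, hk⟩ := hlam
  exact hu.eigenvalue_pos hp hk1 hk

lemma IsEigenfunction.zeroCount_eq (hp : IsCoefficients (2 * π) (weight p) (weight (dual p)))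
    (hv : IsEigenfunction p lam v) (hk1 : 1 ≤ k) (hlam : lam ∈ eigenvaluesOfIndex p k) :
    zeroCount (2 * π) v = (2 * k : ℕ) := by
  obtain ⟨u, hu, hk⟩ := hlam
  have hu_count := (hu.isEigen hp).zeroCount_eq hp hu.ne_zero (hu.eigenvalue_pos hp hk1 hk)
    (integral_angularSpeed_eq hk)
  rw [← hu_count]
  exact le_antisymm
    ((hv.isEigen hp).zeroCount_le_of_same_eigenvalue hp (hu.isEigen hp) hv.ne_zero)
    ((hu.isEigen hp).zeroCount_le_of_same_eigenvalue hp (hv.isEigen hp) hu.ne_zero)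

lemma index_unique (hp : IsCoefficients (2 * π) (weight p) (weight (dual p))) {l : ℕ}
    (hk1 : 1 ≤ k) (hl1 : 1 ≤ l) (hk : lam ∈ eigenvaluesOfIndex p k)
    (hl : lam ∈ eigenvaluesOfIndex p l) : k = l := by
  obtain ⟨v, hv, -⟩ := id hk
  have hcount := (hv.zeroCount_eq hp hk1 hk).symm.trans (hv.zeroCount_eq hp hl1 hl)
  rw [Nat.cast_inj] at hcount
  omega

lemma finite_eigenvaluesOfIndex (hp : IsCoefficients (2 * π) (weight p) (weight (dual p)))
    (hk1 : 1 ≤ k) : (eigenvaluesOfIndex p k).Finite := by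
  by_contra hinf
  obtain ⟨S, hS, hcard⟩ := Set.Infinite.exists_subset_card_eq hinf (2 * k + 2)
  choose u hu _ using fun lam : S => hS lam.2
  have heigen : ∀ lam : S, IsEigen (2 * π) (weight p) (weight (dual p)) lam (u lam)
      (quasiDeriv p (u lam)) := fun lam => (hu lam).isEigen hp
  have hind : LinearIndependent ℝ u := linearIndependent_of_integral_mul_eq_zero hp.continuous_r
    (fun lam => (heigen lam).continuous_u)
    (fun lam mu hne => (heigen lam).integral_mul_eq_zero hp (heigen mu) (Subtype.coe_ne_coe.2 hne))
    fun lam => (hp.integral_mul_self_pos (heigen lam).continuous_u (hu lam).periodic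
      (hu lam).ne_zero).ne'
  have hle := card_le_of_zeroCount_le hp heigen hind fun lam =>
    ((hu lam).zeroCount_eq hp hk1 (hS lam.2)).le
  rw [Fintype.card_coe, hcard] at hle
  omega

end Eigenfunctions

section Eigenbasis

variable {p : ℝ → ℝ × ℝ} {e : ℕ → Fin 2 → ℝ → ℝ} {k l m : ℕ}

lemma innerProd_comm (f g : ℝ → ℝ) : innerProd p f g = innerProd p g f := by
  simp only [innerProd, mul_comm (f _)]

lemma IsEigenbasis.nonempty_eigenvaluesOfIndex
    (hp : IsCoefficients (2 * π) (weight p) (weight (dual p))) (he : IsEigenbasis p e)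
    (hk1 : 1 ≤ k) : (eigenvaluesOfIndex p k).Nonempty := by
  by_contra! hempty
  -- `sInf ∅ = sSup ∅ = 0`, so `e k 0` and `e k 1` would both be constant
  have hconst : ∀ i x, e k i x = e k i 0 := fun i => by
    have heigen := (he.isEigenfunction k hk1 i).isEigen hp
    rw [show eigenvalue p k i = 0 by simp [eigenvalue, hempty]] at heigen
    exact heigen.eq_const hp
  have hinner : ∀ i j, innerProd p (e k i) (e k j) =
      e k i 0 * e k j 0 * ∫ x in (0 : ℝ)..(2 * π), weight p x := fun i j => by
    rw [innerProd, ← intervalIntegral.integral_const_mul]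
    simp only [hconst i _, hconst j _]
  have hone : ∀ i, e k i 0 * e k i 0 * ∫ x in (0 : ℝ)..(2 * π), weight p x = 1 := fun i => by
    rw [← hinner, he.orthonormal k hk1, if_pos rfl]
  have hzero : e k 0 0 * e k 1 0 * ∫ x in (0 : ℝ)..(2 * π), weight p x = 0 := by
    rw [← hinner, he.orthonormal k hk1, if_neg zero_ne_one]
  have h0 := left_ne_zero_of_mul (left_ne_zero_of_mul_eq_one (hone 0))
  have h1 := left_ne_zero_of_mul (left_ne_zero_of_mul_eq_one (hone 1))
  exact mul_ne_zero (mul_ne_zero h0 h1) (right_ne_zero_of_mul_eq_one (hone 0)) hzero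

lemma IsEigenbasis.eigenvalue_mem (hp : IsCoefficients (2 * π) (weight p) (weight (dual p)))
    (he : IsEigenbasis p e) (hk1 : 1 ≤ k) (i : Fin 2) :
    eigenvalue p k i ∈ eigenvaluesOfIndex p k := by
  have hne := he.nonempty_eigenvaluesOfIndex hp hk1
  have hfin := finite_eigenvaluesOfIndex hp hk1
  rw [eigenvalue]
  split_ifs
  · exact hne.csInf_mem hfin
  · exact hne.csSup_mem hfin

lemma IsEigenbasis.innerProd_eq_zero_of_ne
    (hp : IsCoefficients (2 * π) (weight p) (weight (dual p))) (he : IsEigenbasis p e)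
    (hk1 : 1 ≤ k) (hl1 : 1 ≤ l) (hkl : k ≠ l) (i j : Fin 2) :
    innerProd p (e k i) (e l j) = 0 :=
  ((he.isEigenfunction k hk1 i).isEigen hp).integral_mul_eq_zero hp
    ((he.isEigenfunction l hl1 j).isEigen hp) fun heq => hkl (index_unique hp hk1 hl1
      (he.eigenvalue_mem hp hk1 i) (heq ▸ he.eigenvalue_mem hp hl1 j))

/-- The modes of index at most `m`: the constant `1` and the functions `e k i` with `1 ≤ k ≤ m`. -/
def modes (e : ℕ → Fin 2 → ℝ → ℝ) (m : ℕ) : Option (Fin m × Fin 2) → ℝ → ℝ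
  | none => fun _ => 1
  | some (k, i) => e (k + 1) i

/-- The eigenvalues of the modes of index at most `m`. -/
noncomputable def modeEigenvalue (p : ℝ → ℝ × ℝ) (m : ℕ) : Option (Fin m × Fin 2) → ℝ
  | none => 0
  | some (k, i) => eigenvalue p (k + 1) i

lemma isEigen_one (p : ℝ → ℝ × ℝ) :
    IsEigen (2 * π) (weight p) (weight (dual p)) 0 (fun _ => 1) (quasiDeriv p fun _ => 1) := by
  have hw : (quasiDeriv p fun _ => 1) = fun _ => 0 := by
    funext x
    simp [quasiDeriv]
  rw [hw]
  exact ⟨fun x => by simpa using hasDerivAt_const x (1 : ℝ),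
    fun x => by simpa using hasDerivAt_const x (0 : ℝ), fun _ => rfl, fun _ => rfl, fun _ => rfl⟩

lemma IsEigenbasis.innerProd_one (hp : IsCoefficients (2 * π) (weight p) (weight (dual p)))
    (he : IsEigenbasis p e) (hk1 : 1 ≤ k) (i : Fin 2) : innerProd p (e k i) (fun _ => 1) = 0 :=
  ((he.isEigenfunction k hk1 i).isEigen hp).integral_mul_eq_zero hp (isEigen_one p)
    (eigenvalue_pos_of_mem hp hk1 (he.eigenvalue_mem hp hk1 i)).ne'

lemma IsEigenbasis.isEigen_modes (hp : IsCoefficients (2 * π) (weight p) (weight (dual p)))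
    (he : IsEigenbasis p e) (j : Option (Fin m × Fin 2)) :
    IsEigen (2 * π) (weight p) (weight (dual p)) (modeEigenvalue p m j) (modes e m j)
      (quasiDeriv p (modes e m j)) := by
  rcases j with _ | ⟨k, i⟩
  · exact isEigen_one p
  · exact (he.isEigenfunction _ (by omega) i).isEigen hp

lemma IsEigenbasis.modes_ne_zero (he : IsEigenbasis p e) (j : Option (Fin m × Fin 2)) :
    modes e m j ≠ 0 := by
  rcases j with _ | ⟨k, i⟩
  · exact fun h => one_ne_zero (congrFun h 0)
  · exact (he.isEigenfunction _ (by omega) i).ne_zero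

lemma IsEigenbasis.innerProd_modes_eq_zero
    (hp : IsCoefficients (2 * π) (weight p) (weight (dual p))) (he : IsEigenbasis p e)
    {j l : Option (Fin m × Fin 2)} (hjl : j ≠ l) : innerProd p (modes e m j) (modes e m l) = 0 := by
  rcases j with _ | ⟨k, i⟩ <;> rcases l with _ | ⟨k', i'⟩
  · exact absurd rfl hjl
  · rw [innerProd_comm]
    exact he.innerProd_one hp (by omega) i'
  · exact he.innerProd_one hp (by omega) i
  · by_cases hk : k = k'
    · subst hk
      have hi : i ≠ i' := fun h => hjl (by rw [h])
      exact (he.orthonormal (k + 1) (by omega) i i').trans (if_neg hi)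
    · exact he.innerProd_eq_zero_of_ne hp (by omega) (by omega) (by omega) i i'

lemma IsEigenbasis.linearIndependent_modes
    (hp : IsCoefficients (2 * π) (weight p) (weight (dual p))) (he : IsEigenbasis p e) (m : ℕ) :
    LinearIndependent ℝ (modes e m) :=
  linearIndependent_of_integral_mul_eq_zero hp.continuous_r
    (fun j => (he.isEigen_modes hp j).continuous_u) (fun _ _ => he.innerProd_modes_eq_zero hp)
    fun j => (hp.integral_mul_self_pos (he.isEigen_modes hp j).continuous_u
      (he.isEigen_modes hp j).periodic_u (he.modes_ne_zero j)).ne'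

lemma IsEigenbasis.zeroCount_modes_le
    (hp : IsCoefficients (2 * π) (weight p) (weight (dual p))) (he : IsEigenbasis p e)
    (j : Option (Fin m × Fin 2)) : zeroCount (2 * π) (modes e m j) ≤ (2 * m : ℕ) := by
  rcases j with _ | ⟨k, i⟩
  · simp [zeroCount, modes]
  · rw [modes, (he.isEigenfunction _ (by omega) i).zeroCount_eq hp (by omega)
      (he.eigenvalue_mem hp (by omega) i), Nat.cast_le]
    omega

end Eigenbasis

section Expansion

variable {p : ℝ → ℝ × ℝ} {e : ℕ → Fin 2 → ℝ → ℝ} {k₀ m : ℕ} {a : ℕ → Fin 2 → ℝ} {f g : ℝ → ℝ}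

lemma HasExpansionFrom.innerProd_eq_zero
    (hp : IsCoefficients (2 * π) (weight p) (weight (dual p))) (hf : Continuous f)
    (hfe : HasExpansionFrom p e k₀ a f) (he : ∀ k i, k₀ ≤ k → Continuous (e k i))
    (hg : Continuous g) (horth : ∀ k i, k₀ ≤ k → innerProd p (e k i) g = 0) :
    innerProd p f g = 0 := by
  have hbundle : ∀ k i, k₀ ≤ k → ∃ E : C(ℝ, ℝ), ⇑E = e k i := fun k i hk =>
    ⟨⟨e k i, he k i hk⟩, rfl⟩
  choose! E hE using hbundle
  let B := weightedForm (2 * π) ⟨weight p, hp.continuous_r⟩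
  let S (n : ℕ) : C(ℝ, ℝ) := ∑ k ∈ Finset.Icc k₀ n, ∑ i, a k i • E k i
  have hS_apply : ∀ n θ, S n θ = ∑ k ∈ Finset.Icc k₀ n, ∑ i, a k i * e k i θ := fun n θ => by
    simp only [S, ContinuousMap.sum_apply, ContinuousMap.smul_apply, smul_eq_mul]
    exact Finset.sum_congr rfl fun k hk => Finset.sum_congr rfl fun i _ => by
      rw [hE k i (Finset.mem_Icc.1 hk).1]
  have hS_orth : ∀ n, B (S n) ⟨g, hg⟩ = 0 := fun n => by
    simp only [S, map_sum, map_smul, LinearMap.sum_apply, LinearMap.smul_apply]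
    refine Finset.sum_eq_zero fun k hk => Finset.sum_eq_zero fun i _ => ?_
    have hki : B (E k i) ⟨g, hg⟩ = innerProd p (e k i) g := by
      rw [← hE k i (Finset.mem_Icc.1 hk).1]
      rfl
    rw [hki, horth k i (Finset.mem_Icc.1 hk).1, smul_zero]
  refine form_eq_zero_of_tendsto (l := atTop) (B := B) (f := ⟨f, hf⟩) (g := ⟨g, hg⟩)
    (isSymm_weightedForm _ _)
    (weightedForm_self_nonneg hp.period_pos.le fun x => (hp.pos_r x).le) hS_orth ?_
  refine hfe.congr fun n => ?_
  simp only [← hS_apply]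
  rfl

lemma HasExpansionFrom.innerProd_modes
    (hp : IsCoefficients (2 * π) (weight p) (weight (dual p))) (he : IsEigenbasis p e)
    (hm : m < k₀) (hf : Continuous f) (hfe : HasExpansionFrom p e k₀ a f)
    (j : Option (Fin m × Fin 2)) : innerProd p f (modes e m j) = 0 := by
  refine hfe.innerProd_eq_zero hp hf
    (fun k i hk => ((he.isEigenfunction k (by omega) i).isEigen hp).continuous_u)
    (he.isEigen_modes hp j).continuous_u fun k i hk => ?_
  rcases j with _ | ⟨l, j⟩
  · exact he.innerProd_one hp (by omega) i
  · exact he.innerProd_eq_zero_of_ne hp (by omega) (by omega) (by omega) i j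

end Expansion

end MinkowskiPlane

open MinkowskiPlane SturmLiouville in
theorem mainTheorem7_general (p : ℝ → ℝ × ℝ)
    (hp : IsCoefficients (2 * Real.pi) (weight p) (weight (dual p)))
    (e : ℕ → Fin 2 → ℝ → ℝ) (he : IsEigenbasis p e) (k₀ : ℕ)
    (h : ℝ → ℝ) (hcont : Continuous h) (hper : Function.Periodic h (2 * Real.pi))
    (a : ℕ → Fin 2 → ℝ) (hh : HasExpansionFrom p e k₀ a h) :
    ((2 * k₀ : ℕ) : ℕ∞) ≤ {θ ∈ Set.Ico 0 (2 * Real.pi) | h θ = 0}.encard := by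
  by_contra! hlt
  have hsub : signChanges (2 * Real.pi) h ⊆ {θ ∈ Set.Ico 0 (2 * Real.pi) | h θ = 0} :=
    fun x hx => ⟨hx.1, by_contra fun h0 => hx.2 (locallyOneSigned_of_ne_zero hcont.continuousAt h0)⟩
  obtain ⟨Z, hZ⟩ := ((Set.finite_of_encard_le_coe hlt.le).subset hsub).exists_finset_coe
  have hcard : Z.card < 2 * k₀ := by
    rw [← Nat.cast_lt (α := ℕ∞), ← Set.encard_coe_eq_coe_finsetCard, hZ]
    exact (Set.encard_le_encard hsub).trans_lt hlt
  have hiso : HasIsolatedZeros h :=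
    hasIsolatedZeros_of_zeroCount_ne_top Real.two_pi_pos hper hlt.ne_top
  obtain ⟨m, hm⟩ := even_card_of_eq_signChanges Real.two_pi_pos hcont hper hiso hZ
  have hZ_card : Z.card = 2 * m := hm.trans (two_mul m).symm
  obtain ⟨j, hj⟩ := exists_integral_mul_ne_zero hp (he.isEigen_modes hp (m := m))
    (he.linearIndependent_modes hp m) hcont hper hiso hZ
    (by simp only [Fintype.card_option, Fintype.card_prod, Fintype.card_fin]; omega)
    (hZ_card ▸ he.zeroCount_modes_le hp)
  exact hj (hh.innerProd_modes hp he (by omega) hcont j)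

theorem mainTheorem7 (N : Seminorm ℝ (ℝ × ℝ)) (p : ℝ → ℝ × ℝ)
    (hp : MinkowskiPlane.IsUnitCircle N p)
    (e : ℕ → Fin 2 → ℝ → ℝ) (he : MinkowskiPlane.IsEigenbasis p e)
    (k₀ : ℕ) (hk₀ : 2 ≤ k₀)
    (h : ℝ → ℝ) (hcont : Continuous h) (hper : Function.Periodic h (2 * Real.pi))
    (a : ℕ → Fin 2 → ℝ) (hh : MinkowskiPlane.HasExpansionFrom p e k₀ a h) :
    ((2 * k₀ : ℕ) : ℕ∞) ≤ {θ ∈ Set.Ico 0 (2 * Real.pi) | h θ = 0}.encard :=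
  mainTheorem7_general p hp.isCoefficients e he k₀ h hcont hper a hh
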